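/- Let $p>q\ge 2$ be integers, let $c\in\mathbb C$, and consider the correspondence $z\mapsto w$ given by $(w-c)^q=z^p$; then $w$ is called an image of $z$. For a finite orbit $(z_0,\dots,z_n)$ (each $z_{i+1}$ an image of $z_i$) avoiding $0$, let $g_{z_0\cdots z_n}=g_{z_{n-1},z_n}\circ\cdots\circ g_{z_0,z_1}$, where $g_{z_i,z_{i+1}}$ is the unique holomorphic germ $g$ at $z_i$ with $(g(z)-c)^q=z^p$ and $g(z_i)=z_{i+1}$. The finite orbit is a repelling cycle of period $n\ge 1$ if $z_n=z_0$, $z_i\ne z_0$ for $0<i<n$, no $z_i$ is $0$, and $|g_{z_0\cdots z_n}'(z_0)|>1$. The Julia set $J\subset\mathbb C$ is the closure of the union of all repelling cycles. Assume that $J$ (nonempty) is a hyperbolic repeller: $J$ is compact, $0\notin J$, the set of points having at least one image in $J$ equals $J$, and there are $C>0$, $\lambda>1$ with $|g_{z_0\cdots z_n}'(z_0)|\ge C\lambda^n$ for all finite orbits $(z_0,\dots,z_n)$ in $J$. Assume also that the correspondence is locally eventually onto on $J$: for every nonempty relatively open $U\subset J$ there is $n>0$ such that the $n$-th iterated image of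 $U$ contains $J$. A $\mathbb C^2$-extension is a holomorphic map $f:V\to\mathbb C^2$ on an open set $V\subset\mathbb C^2$ such that the closure $J(f)$ of the set of its periodic points is a compact subset of $V$, is completely invariant ($f(J(f))=J(f)=f^{-1}(J(f))$), and such that, with $\pi(z,w)=z$, the map $x\mapsto(\pi f^n(x))_{n\ge 0}$ is a bijection (hence a homeomorphism conjugating $f$ to the shift) from $J(f)$ onto the space of forward orbits of the correspondence contained in $J$. Its geometric potential is $\varphi(x)=-\log|g_{z_0,z_1}'(z_0)|$ with $z_0=\pi(x)$, $z_1=\pi f(x)$, $x\in J(f)$. Let $P(\cdot)$ denote the topological pressure of $f:J(f)\to J(f)$. Then $\mathbb C^2$-extensions exist, and there is a real number $t_c>0$ such that, for every $\mathbb C^2$-extension, $t_c$ is the unique zero of $t\mapsto P(t\varphi)$ on $[0,\infty)$. Moreover, the $t_c$-dimensional Hausdorff measure $\mathcal H^{t_c}(J)$ is finite, and $\dim_H J\le t_c$. -/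

import Mathlib

open Filter Topology MeasureTheory

noncomputable section

namespace Corr

/-! ### The correspondence `(w - c)^q = z^p` -/

/-- `w` is an image of `z` under the correspondence `(w - c)^q = z^p`. -/
def IsImage (p q : ℕ) (c z w : ℂ) : Prop := (w - c) ^ q = z ^ p

/-- The set of all images of points of `A`. -/
def imageSet (p q : ℕ) (c : ℂ) (A : Set ℂ) : Set ℂ := {w | ∃ z ∈ A, IsImage p q c z w}

/-- The set of all points with at least one image in `A`. -/
def preimageSet (p q : ℕ) (c : ℂ) (A : Set ℂ) : Set ℂ := {z | ∃ w ∈ A, IsImage p q c z w}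

/-- `(z 0, …, z n)` is a finite orbit (the values of `z` beyond `n` are irrelevant). -/
def IsFiniteOrbit (p q : ℕ) (c : ℂ) (n : ℕ) (z : ℕ → ℂ) : Prop :=
  ∀ i < n, IsImage p q c (z i) (z (i + 1))

/-- The holomorphic branch `g` of the correspondence near `z₀ ≠ 0` with `g z₀ = z₁`, where
`z₁` is an image of `z₀`. The power is the principal one, near `z / z₀ = 1`; see
`localBranch_self`, `eventually_isImage_localBranch` and `eventually_eq_localBranch`. -/
def localBranch (p q : ℕ) (c z₀ z₁ : ℂ) : ℂ → ℂ :=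
  fun z => c + (z₁ - c) * (z / z₀) ^ ((p : ℂ) / (q : ℂ))

/-- The composition `g_{z_{n-1}, z_n} ∘ ⋯ ∘ g_{z_0, z_1}` along a finite orbit. -/
def orbitBranch (p q : ℕ) (c : ℂ) (z : ℕ → ℂ) : ℕ → ℂ → ℂ
  | 0 => id
  | n + 1 => localBranch p q c (z n) (z (n + 1)) ∘ orbitBranch p q c z n

theorem localBranch_self (p q : ℕ) (c z₁ : ℂ) {z₀ : ℂ} (h₀ : z₀ ≠ 0) :
    localBranch p q c z₀ z₁ z₀ = z₁ := by
  simp [localBranch, h₀]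

theorem hasDerivAt_localBranch (p q : ℕ) (c z₁ : ℂ) {z₀ : ℂ} (h₀ : z₀ ≠ 0) :
    HasDerivAt (localBranch p q c z₀ z₁) (p * (z₁ - c) / (q * z₀)) z₀ := by
  have h1 : HasDerivAt (fun z : ℂ => z / z₀) (1 / z₀) z₀ := (hasDerivAt_id z₀).div_const z₀
  have h2 := (h1.cpow_const (c := (p : ℂ) / (q : ℂ)) (by simp [h₀])).const_mul (z₁ - c)
  have h3 := h2.const_add c
  refine HasDerivAt.congr_deriv h3 ?_
  rw [show (z₀ / z₀ : ℂ) = 1 from div_self h₀, Complex.one_cpow, mul_one]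
  field_simp

/-- `localBranch` solves the equation of the correspondence near `z₀`. -/
theorem eventually_isImage_localBranch (p q : ℕ) (c : ℂ) {z₀ z₁ : ℂ} (hq : q ≠ 0)
    (h₀ : z₀ ≠ 0) (h : IsImage p q c z₀ z₁) :
    ∀ᶠ z in 𝓝 z₀, IsImage p q c z (localBranch p q c z₀ z₁ z) := by
  refine Eventually.of_forall fun z => ?_
  have hq' : (q : ℂ) ≠ 0 := by exact_mod_cast hq
  unfold IsImage at *
  simp only [localBranch, add_sub_cancel_left, mul_pow, h]
  rw [← Complex.cpow_mul_nat, div_mul_cancel₀ _ hq', Complex.cpow_natCast, ← mul_pow,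
    mul_div_cancel₀ _ h₀]

/-- `localBranch` is the only continuous solution near `z₀` with value `z₁` at `z₀`. -/
theorem eventually_eq_localBranch (p q : ℕ) (c : ℂ) {z₀ z₁ : ℂ} (hq : q ≠ 0)
    (h₀ : z₀ ≠ 0) {g : ℂ → ℂ} (hg : ContinuousAt g z₀)
    (hg₀ : g z₀ = z₁) (hgi : ∀ᶠ z in 𝓝 z₀, IsImage p q c z (g z)) :
    g =ᶠ[𝓝 z₀] localBranch p q c z₀ z₁ := by
  have h : IsImage p q c z₀ z₁ := hg₀ ▸ hgi.self_of_nhds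
  have hne : z₁ - c ≠ 0 := by
    intro h0
    unfold IsImage at h
    rw [h0, zero_pow hq] at h
    exact pow_ne_zero p h₀ h.symm
  have hb := (hasDerivAt_localBranch p q c z₁ h₀).continuousAt
  have hb₀ := localBranch_self p q c z₁ h₀
  let r : ℂ → ℂ := fun z => (g z - c) / (localBranch p q c z₀ z₁ z - c)
  have hr : ContinuousAt r z₀ :=
    (hg.sub continuousAt_const).div (hb.sub continuousAt_const) (by rw [hb₀]; exact hne)
  have hr₀ : r z₀ = 1 := by simp only [r]; rw [hg₀, hb₀, div_self hne]
  have hfin : ({x : ℂ | x ^ q = 1} \ {1}).Finite := by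
    refine Set.Finite.subset (Polynomial.nthRootsFinset q (1 : ℂ)).finite_toSet ?_
    intro x hx
    simpa [Polynomial.mem_nthRootsFinset (Nat.pos_of_ne_zero hq)] using hx.1
  have hop : ({x : ℂ | x ^ q = 1} \ {1})ᶜ ∈ 𝓝 (r z₀) := by
    rw [hr₀]
    exact hfin.isClosed.isOpen_compl.mem_nhds (by simp)
  have hbne : ∀ᶠ z in 𝓝 z₀, localBranch p q c z₀ z₁ z - c ≠ 0 :=
    ContinuousAt.eventually_ne (g := fun z => localBranch p q c z₀ z₁ z - c)
      (hb.sub continuousAt_const) (by rw [hb₀]; exact hne)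
  filter_upwards [hr hop, hgi, eventually_isImage_localBranch p q c hq h₀ h, hbne]
    with z h1 h2 h3 h4
  have hrz : r z ^ q = 1 := by
    simp only [r, div_pow]
    unfold IsImage at h2 h3
    rw [h2, ← h3, div_self (pow_ne_zero _ h4)]
  have hr1 : r z = 1 := by
    by_contra hcon
    exact h1 ⟨hrz, hcon⟩
  have := (div_eq_one_iff_eq h4).1 hr1
  exact sub_left_injective this

/-! ### Julia set, hyperbolic repellers -/

/-- `(z 0, …, z n)` is a repelling cycle of period `n`; none of its points is zero. -/
def IsRepellingCycle (p q : ℕ) (c : ℂ) (n : ℕ) (z : ℕ → ℂ) : Prop :=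
  0 < n ∧ IsFiniteOrbit p q c n z ∧ z n = z 0 ∧ (∀ i, 0 < i → i < n → z i ≠ z 0) ∧
    (∀ i ≤ n, z i ≠ 0) ∧ 1 < ‖deriv (orbitBranch p q c z n) (z 0)‖

/-- The Julia set: the closure of the union of all repelling cycles. -/
def juliaSet (p q : ℕ) (c : ℂ) : Set ℂ :=
  closure {w | ∃ n z, IsRepellingCycle p q c n z ∧ ∃ i ≤ n, z i = w}

structure IsHyperbolicRepeller (p q : ℕ) (c : ℂ) (Λ : Set ℂ) : Prop where
  isCompact : IsCompact Λ
  zero_notMem : (0 : ℂ) ∉ Λ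
  preimage_eq : preimageSet p q c Λ = Λ
  expanding : ∃ C > (0 : ℝ), ∃ l > (1 : ℝ), ∀ (n : ℕ) (z : ℕ → ℂ), IsFiniteOrbit p q c n z →
    (∀ i ≤ n, z i ∈ Λ) → C * l ^ n ≤ ‖deriv (orbitBranch p q c z n) (z 0)‖

/-- Locally eventually onto: each nonempty relatively open subset `O ∩ Λ` of `Λ` is mapped over
`Λ` by some iterate of the correspondence. -/
def IsLEO (p q : ℕ) (c : ℂ) (Λ : Set ℂ) : Prop :=
  ∀ O : Set ℂ, IsOpen O → (O ∩ Λ).Nonempty → ∃ n > 0, Λ ⊆ (imageSet p q c)^[n] (O ∩ Λ)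

/-! ### Extensions to `ℂ²` -/

/-- The closure in `ℂ²` of the set of periodic points of the map `f : V → ℂ²`. The values of `f`
outside `V` play no role: the whole orbit has to lie in `V`. -/
def closurePeriodicPts (V : Set (ℂ × ℂ)) (f : ℂ × ℂ → ℂ × ℂ) : Set (ℂ × ℂ) :=
  closure {x | (∃ n > 0, f^[n] x = x) ∧ ∀ i, f^[i] x ∈ V}

/-- The projected orbit of `x`: the first coordinates of its iterates. -/
def projectedOrbit (f : ℂ × ℂ → ℂ × ℂ) (x : ℂ × ℂ) : ℕ → ℂ := fun n => (f^[n] x).1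

/-- The set of all forward orbits of the correspondence contained in `Λ`. -/
def orbitSpace (p q : ℕ) (c : ℂ) (Λ : Set ℂ) : Set (ℕ → ℂ) :=
  {z | ∀ i, z i ∈ Λ ∧ IsImage p q c (z i) (z (i + 1))}

/-- The holomorphic map `f : V → ℂ²` is a `ℂ²`-extension of the correspondence: the closure
`J(f)` of its periodic points is a compact subset of `V`, completely invariant, and taking
projected orbits is a bijection from `J(f)` onto the space of forward orbits in the Julia set.
(This bijection is continuous, hence a homeomorphism for the product topology, and it conjugates
`f` to the shift.) -/
structure IsC2Extension (p q : ℕ) (c : ℂ) (V : Set (ℂ × ℂ)) (f : ℂ × ℂ → ℂ × ℂ) : Prop where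
  isOpen : IsOpen V
  holomorphic : DifferentiableOn ℂ f V
  isCompact : IsCompact (closurePeriodicPts V f)
  subset : closurePeriodicPts V f ⊆ V
  image_eq : f '' closurePeriodicPts V f = closurePeriodicPts V f
  preimage_eq : V ∩ f ⁻¹' closurePeriodicPts V f = closurePeriodicPts V f
  bijOn : Set.BijOn (projectedOrbit f) (closurePeriodicPts V f)
    (orbitSpace p q c (juliaSet p q c))

/-- The geometric potential `x ↦ -log |g_{z₀, z₁}'(z₀)|`, where `z₀, z₁` are the first two points
of the projected orbit of `x`. -/
def geometricPotential (p q : ℕ) (c : ℂ) (f : ℂ × ℂ → ℂ × ℂ) (x : ℂ × ℂ) : ℝ :=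
  -Real.log ‖deriv (localBranch p q c (projectedOrbit f x 0) (projectedOrbit f x 1))
    (projectedOrbit f x 0)‖

/-! ### Topological pressure -/

/-- `E` is an `(n, ε)`-separated subset of `K`. -/
def IsSeparatedIn {X : Type*} [MetricSpace X] (f : X → X) (K : Set X) (n : ℕ) (ε : ℝ)
    (E : Finset X) : Prop :=
  (E : Set X) ⊆ K ∧ ∀ x ∈ E, ∀ y ∈ E, x ≠ y → ∃ j < n, ε < dist (f^[j] x) (f^[j] y)

/-- The supremum of `∑ x ∈ E, exp (S_n φ x)` over all `(n, ε)`-separated subsets `E` of `K`. -/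
def partitionSup {X : Type*} [MetricSpace X] (f : X → X) (K : Set X) (φ : X → ℝ) (n : ℕ)
    (ε : ℝ) : ENNReal :=
  ⨆ (E : Finset X) (_ : IsSeparatedIn f K n ε E),
    ∑ x ∈ E, ENNReal.ofReal (Real.exp (birkhoffSum f φ n x))

/-- The topological pressure of the potential `φ` for `f : K → K`, `K` compact:
`lim_{ε → 0} limsup_n (1/n) log sup_E ∑_{x ∈ E} exp (S_n φ x)`, `E` ranging over the
`(n, ε)`-separated sets; the limit as `ε → 0` is a supremum by monotonicity. -/
def pressure {X : Type*} [MetricSpace X] (f : X → X) (K : Set X) (φ : X → ℝ) : EReal :=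
  ⨆ (ε : ℝ) (_ : 0 < ε),
    limsup (fun n : ℕ => ENNReal.log (partitionSup f K φ n ε) / ((n : ℝ) : EReal)) atTop

end Corr

end

/-!
On the repeller the local branches expand along orbits, so backward branches contract with bounded
distortion. With local eventual ontoness, the transfer sums `∑ |g'(z₀)|⁻ˢ` over the `n`-step
backward orbits of a point of the Julia set do not depend on that point up to a bounded factor;
hence they are almost multiplicative in `n` and grow like `exp (n P(s))`. This `P(s)` is the
pressure of `s φ` for every `ℂ²`-extension, since orbits of an extension that are separated up to
time `n` correspond, with bounded multiplicity, to `n`-step backward orbits. Expansion makes `P`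
strictly decreasing, and `P(0) > 0` because a point other than `c` has several preimages, so `P` has
exactly one zero `t`. At `t` the transfer sums are bounded, and pulling back small balls along all
backward orbits covers the Julia set by small sets with bounded sums of `diam ^ t`.

For an extension, an orbit `z` is coded as `(z 0, ∑ εⁱ z (i + 1))` with `ε` small: since distinct
images of a point are uniformly apart, the second coordinate determines `z 1`, so the shift is
holomorphic in these coordinates. An Anosov closing lemma makes periodic orbits dense.
-/

noncomputable section

namespace Corr

section General

/-- The concatenation of two sequences: `x` up to time `n`, followed by `y` started at time `n`. -/
def glue {α : Type*} (n : ℕ) (x y : ℕ → α) : ℕ → α := fun i => if i ≤ n then x i else y (i - n)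

theorem glue_of_le {α : Type*} {n i : ℕ} (h : i ≤ n) (x y : ℕ → α) : glue n x y i = x i :=
  if_pos h

theorem glue_add {α : Type*} {n : ℕ} {x y : ℕ → α} (h : x n = y 0) (i : ℕ) :
    glue n x y (n + i) = y i := by
  rcases Nat.eq_zero_or_pos i with rfl | hi
  · simp [glue, h]
  · rw [glue, if_neg (by omega), Nat.add_sub_cancel_left]

/-- The sequence `x`, shifted by one place, with the initial value `a`. -/
def cons {α : Type*} (a : α) (x : ℕ → α) : ℕ → α
  | 0 => a
  | i + 1 => x i

theorem exists_eq_of_pow_eq_of_norm_sub_lt {K : Type*} [NormedField K] {k : ℕ} (hk : k ≠ 0) :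
    ∃ κ > (0 : ℝ), ∀ u v : K, u ^ k = v ^ k → ‖u - v‖ < κ * ‖v‖ → u = v := by
  have finite_roots : ({x : K | x ^ k = 1} \ {1}).Finite := by
    refine Set.Finite.subset (Polynomial.nthRootsFinset k (1 : K)).finite_toSet fun x hx => ?_
    simpa [Polynomial.mem_nthRootsFinset (Nat.pos_of_ne_zero hk)] using hx.1
  obtain ⟨κ, hκ, isolated⟩ := Metric.mem_nhds_iff.1
    (finite_roots.isClosed.isOpen_compl.mem_nhds (by simp : (1 : K) ∈ _))
  refine ⟨κ, hκ, fun u v huv hlt => ?_⟩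
  have hv : v ≠ 0 := by
    rintro rfl
    simp only [norm_zero, mul_zero] at hlt
    exact absurd hlt (norm_nonneg _).not_gt
  have hmem : u / v ∈ Metric.ball (1 : K) κ := by
    rwa [mem_ball_iff_norm, div_sub_one hv, norm_div, div_lt_iff₀ (norm_pos_iff.2 hv)]
  by_contra hne
  refine isolated hmem ⟨?_, fun h1 => hne ((div_eq_one_iff_eq hv).1 h1)⟩
  rw [Set.mem_ofPred_eq, div_pow, huv, div_self (pow_ne_zero _ hv)]

theorem norm_one_add_cpow_le {β ρ : ℝ} (h1 : -1 ≤ β) (h0 : β ≤ 0) (hρ : ρ ≤ 1 / 2) {x : ℂ}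
    (hx : ‖x‖ ≤ ρ) : ‖(1 + x) ^ (β : ℂ)‖ ≤ 1 + 2 * ρ := by
  have hρ0 : 0 ≤ ρ := (norm_nonneg x).trans hx
  have hpos : 0 < 1 - ρ := by linarith
  have hlow : 1 - ρ ≤ ‖1 + x‖ := by
    have := norm_sub_norm_le (1 : ℂ) (-x)
    simp only [norm_one, norm_neg, sub_neg_eq_add] at this
    linarith
  rw [Complex.norm_cpow_real]
  calc ‖1 + x‖ ^ β ≤ (1 - ρ) ^ β := Real.rpow_le_rpow_of_nonpos hpos hlow h0
    _ ≤ (1 - ρ) ^ (-1 : ℝ) := Real.rpow_le_rpow_of_exponent_ge hpos (by linarith) h1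
    _ ≤ 1 + 2 * ρ := by
        rw [Real.rpow_neg_one, inv_le_iff_one_le_mul₀ hpos]
        nlinarith

theorem norm_one_add_cpow_sub_one_le {α : ℝ} (h0 : 0 ≤ α) (h1 : α ≤ 1) {u : ℂ}
    (hu : ‖u‖ ≤ 1 / 2) : ‖(1 + u) ^ (α : ℂ) - 1‖ ≤ α * (1 + 2 * ‖u‖) * ‖u‖ := by
  have hderiv : ∀ x ∈ Metric.closedBall (0 : ℂ) ‖u‖,
      HasDerivWithinAt (fun x : ℂ => (1 + x) ^ (α : ℂ)) (α * (1 + x) ^ ((α : ℂ) - 1))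
        (Metric.closedBall (0 : ℂ) ‖u‖) x := by
    intro x hx
    have hx' : ‖x‖ ≤ ‖u‖ := mem_closedBall_zero_iff.1 hx
    have := ((hasDerivAt_id x).const_add 1).cpow_const (c := (α : ℂ))
      (Complex.mem_slitPlane_of_norm_lt_one (z := x) (by linarith))
    simpa using this.hasDerivWithinAt
  have hle : ∀ x ∈ Metric.closedBall (0 : ℂ) ‖u‖,
      ‖(α * (1 + x) ^ ((α : ℂ) - 1) : ℂ)‖ ≤ α * (1 + 2 * ‖u‖) := by
    intro x hx
    rw [norm_mul, Complex.norm_real, Real.norm_of_nonneg h0]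
    have := norm_one_add_cpow_le (β := α - 1) (by linarith) (by linarith) hu
      (mem_closedBall_zero_iff.1 hx)
    push_cast at this
    gcongr
  simpa using (convex_closedBall (0 : ℂ) ‖u‖).norm_image_sub_le_of_norm_hasDerivWithin_le hderiv
    hle (Metric.mem_closedBall_self (norm_nonneg u)) (by simp : u ∈ Metric.closedBall (0 : ℂ) ‖u‖)

end General

section FiniteOrbits

variable {p q : ℕ} {c : ℂ}

theorem IsImage.sub_ne_zero {z w : ℂ} (hq : q ≠ 0) (h : IsImage p q c z w) (hz : z ≠ 0) :
    w - c ≠ 0 := by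
  intro h0
  rw [IsImage, h0, zero_pow hq] at h
  exact pow_ne_zero p hz h.symm

theorem IsFiniteOrbit.mono {m n : ℕ} {z : ℕ → ℂ} (h : IsFiniteOrbit p q c n z) (hmn : m ≤ n) :
    IsFiniteOrbit p q c m z :=
  fun i hi => h i (hi.trans_le hmn)

theorem IsFiniteOrbit.drop {m n : ℕ} {z : ℕ → ℂ} (h : IsFiniteOrbit p q c (m + n) z) :
    IsFiniteOrbit p q c n fun i => z (m + i) :=
  fun i hi => h (m + i) (by omega)

theorem IsFiniteOrbit.tail {n : ℕ} {z : ℕ → ℂ} (h : IsFiniteOrbit p q c (n + 1) z) :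
    IsFiniteOrbit p q c n fun i => z (i + 1) :=
  fun i hi => h (i + 1) (by omega)

theorem IsFiniteOrbit.cons {n : ℕ} {x₀ : ℂ} {x : ℕ → ℂ} (h : IsFiniteOrbit p q c n x)
    (h₀ : IsImage p q c x₀ (x 0)) :
    IsFiniteOrbit p q c (n + 1) (Corr.cons x₀ x)
  | 0, _ => h₀
  | i + 1, hi => h i (Nat.lt_of_succ_lt_succ hi)

theorem IsFiniteOrbit.congr {n : ℕ} {x y : ℕ → ℂ} (h : IsFiniteOrbit p q c n x)
    (hxy : ∀ i ≤ n, y i = x i) : IsFiniteOrbit p q c n y := by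
  intro i hi
  rw [hxy i hi.le, hxy (i + 1) hi]
  exact h i hi

theorem IsFiniteOrbit.glue {m n : ℕ} {x y : ℕ → ℂ} (hx : IsFiniteOrbit p q c n x)
    (hy : IsFiniteOrbit p q c m y) (h : x n = y 0) :
    IsFiniteOrbit p q c (n + m) (Corr.glue n x y) := by
  intro i hi
  rcases lt_or_ge i n with h1 | h1
  · rw [glue_of_le h1.le, glue_of_le h1]
    exact hx i h1
  · obtain ⟨k, rfl⟩ := Nat.exists_eq_add_of_le h1
    rw [add_assoc, glue_add h, glue_add h]
    exact hy k (by omega)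

theorem mem_iterate_imageSet {n : ℕ} {A : Set ℂ} {w : ℂ} :
    w ∈ (imageSet p q c)^[n] A ↔ ∃ y, IsFiniteOrbit p q c n y ∧ y 0 ∈ A ∧ y n = w := by
  induction n generalizing A with
  | zero =>
    refine ⟨fun h => ⟨fun _ => w, fun i hi => absurd hi i.not_lt_zero, h, rfl⟩, ?_⟩
    rintro ⟨y, -, hy, rfl⟩
    exact hy
  | succ n ih =>
    rw [Function.iterate_succ_apply, ih]
    constructor
    · rintro ⟨y, hy, ⟨x₀, hx₀, h⟩, hw⟩
      exact ⟨_, hy.cons h, hx₀, hw⟩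
    · rintro ⟨y, hy, h₀, hw⟩
      exact ⟨_, hy.tail, ⟨y 0, h₀, hy 0 n.succ_pos⟩, hw⟩

end FiniteOrbits

section Derivative

variable {p q : ℕ} {c : ℂ}

/-- The logarithm of the modulus of the derivative at `z` of every branch of the correspondence;
see `norm_deriv_localBranch`. -/
def logExpansion (p q : ℕ) (z : ℂ) : ℝ :=
  Real.log ((p : ℝ) / q) + ((p : ℝ) / q - 1) * Real.log ‖z‖

/-- The Birkhoff sum of `logExpansion` along the first `n` points of a sequence. -/
def logExpansionSum (p q : ℕ) (z : ℕ → ℂ) (n : ℕ) : ℝ :=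
  ∑ i ∈ Finset.range n, logExpansion p q (z i)

theorem logExpansionSum_zero (z : ℕ → ℂ) : logExpansionSum p q z 0 = 0 :=
  Finset.sum_range_zero _

theorem logExpansionSum_succ (z : ℕ → ℂ) (n : ℕ) :
    logExpansionSum p q z (n + 1) = logExpansionSum p q z n + logExpansion p q (z n) :=
  Finset.sum_range_succ _ _

theorem logExpansionSum_succ' (z : ℕ → ℂ) (n : ℕ) :
    logExpansionSum p q z (n + 1) =
      logExpansion p q (z 0) + logExpansionSum p q (fun i => z (i + 1)) n :=
  (Finset.sum_range_succ' _ _).trans (add_comm _ _)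

theorem logExpansionSum_add (z : ℕ → ℂ) (m n : ℕ) :
    logExpansionSum p q z (m + n) =
      logExpansionSum p q z m + logExpansionSum p q (fun i => z (m + i)) n :=
  Finset.sum_range_add _ _ _

theorem logExpansionSum_congr {x y : ℕ → ℂ} {n : ℕ} (h : ∀ i < n, x i = y i) :
    logExpansionSum p q x n = logExpansionSum p q y n :=
  Finset.sum_congr rfl fun i hi => by rw [h i (Finset.mem_range.1 hi)]

theorem IsImage.log_norm_sub {z w : ℂ} (hq : q ≠ 0) (h : IsImage p q c z w) :
    Real.log ‖w - c‖ = (p : ℝ) / q * Real.log ‖z‖ := by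
  have hlog := congrArg (fun u : ℂ => Real.log ‖u‖) h
  simp only [norm_pow, Real.log_pow] at hlog
  have hq' : (q : ℝ) ≠ 0 := by exact_mod_cast hq
  field_simp
  linarith

theorem IsImage.norm_deriv {z w : ℂ} (hp : p ≠ 0) (hq : q ≠ 0) (h : IsImage p q c z w)
    (hz : z ≠ 0) : ‖(p * (w - c) / (q * z) : ℂ)‖ = Real.exp (logExpansion p q z) := by
  have hw : 0 < ‖w - c‖ := norm_pos_iff.2 (h.sub_ne_zero hq hz)
  have hz' : 0 < ‖z‖ := norm_pos_iff.2 hz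
  rw [logExpansion, sub_mul, ← h.log_norm_sub hq, one_mul, ← Real.log_div hw.ne' hz'.ne',
    ← Real.log_mul (by positivity) (by positivity), Real.exp_log (by positivity)]
  simp only [norm_div, norm_mul, Complex.norm_natCast]
  field_simp

theorem norm_deriv_localBranch {z w : ℂ} (hp : p ≠ 0) (hq : q ≠ 0) (h : IsImage p q c z w)
    (hz : z ≠ 0) : ‖deriv (localBranch p q c z w) z‖ = Real.exp (logExpansion p q z) := by
  rw [(hasDerivAt_localBranch p q c w hz).deriv, h.norm_deriv hp hq hz]

theorem orbitBranch_self {z : ℕ → ℂ} {n : ℕ} (hz : ∀ i < n, z i ≠ 0) :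
    orbitBranch p q c z n (z 0) = z n := by
  induction n with
  | zero => rfl
  | succ n ih =>
    rw [orbitBranch, Function.comp_apply, ih fun i hi => hz i (by omega),
      localBranch_self p q c _ (hz n n.lt_succ_self)]

theorem differentiableAt_orbitBranch {z : ℕ → ℂ} {n : ℕ} (hz : ∀ i < n, z i ≠ 0) :
    DifferentiableAt ℂ (orbitBranch p q c z n) (z 0) := by
  induction n with
  | zero => exact differentiableAt_id
  | succ n ih =>
    have hz' : ∀ i < n, z i ≠ 0 := fun i hi => hz i (by omega)
    refine DifferentiableAt.comp _ ?_ (ih hz')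
    rw [orbitBranch_self hz']
    exact (hasDerivAt_localBranch p q c _ (hz n n.lt_succ_self)).differentiableAt

theorem IsFiniteOrbit.norm_deriv_orbitBranch (hp : p ≠ 0) (hq : q ≠ 0) {z : ℕ → ℂ} {n : ℕ}
    (h : IsFiniteOrbit p q c n z) (hz : ∀ i < n, z i ≠ 0) :
    ‖deriv (orbitBranch p q c z n) (z 0)‖ = Real.exp (logExpansionSum p q z n) := by
  induction n with
  | zero => simp [orbitBranch, logExpansionSum]
  | succ n ih =>
    have hz' : ∀ i < n, z i ≠ 0 := fun i hi => hz i (by omega)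
    have hn : z n ≠ 0 := hz n n.lt_succ_self
    have hbranch : DifferentiableAt ℂ (localBranch p q c (z n) (z (n + 1)))
        (orbitBranch p q c z n (z 0)) := by
      rw [orbitBranch_self hz']
      exact (hasDerivAt_localBranch p q c _ hn).differentiableAt
    rw [orbitBranch, deriv_comp _ hbranch (differentiableAt_orbitBranch hz'), norm_mul,
      ih (h.mono n.le_succ) hz', orbitBranch_self hz',
      norm_deriv_localBranch hp hq (h n n.lt_succ_self) hn, logExpansionSum_succ, ← Real.exp_add,
      add_comm]

theorem IsImage.exists_isImage_norm_sub_le {y₀ y₁ w : ℂ} (hq : q ≠ 0) (hpq : q ≤ p)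
    (h : IsImage p q c y₀ y₁) (h₀ : y₀ ≠ 0) (hw : ‖w - y₁‖ ≤ ‖y₁ - c‖ / 2) :
    ∃ x, IsImage p q c x w ∧ ‖x - y₀‖ ≤
      Real.exp (-logExpansion p q y₀) * (1 + 2 / ‖y₁ - c‖ * ‖w - y₁‖) * ‖w - y₁‖ := by
  have hp : p ≠ 0 := by omega
  have h₁ : y₁ - c ≠ 0 := h.sub_ne_zero hq h₀
  have h₁' : 0 < ‖y₁ - c‖ := norm_pos_iff.2 h₁
  have h₀' : 0 < ‖y₀‖ := norm_pos_iff.2 h₀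
  have hq' : (0 : ℝ) < q := by positivity
  have hp' : (0 : ℝ) < p := by positivity
  have hpC : (p : ℂ) ≠ 0 := by exact_mod_cast hp
  obtain ⟨u, rfl⟩ : ∃ u, w = y₁ + u * (y₁ - c) := ⟨(w - y₁) / (y₁ - c), by field_simp; ring⟩
  simp only [add_sub_cancel_left, norm_mul] at hw ⊢
  have hu : ‖u‖ ≤ 1 / 2 := le_of_mul_le_mul_right (by linarith) h₁'
  have hpow := norm_one_add_cpow_sub_one_le (α := (q : ℝ) / p) (by positivity)
    ((div_le_one hp').2 (by exact_mod_cast hpq)) hu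
  refine ⟨y₀ * (1 + u) ^ (((q : ℝ) / p : ℝ) : ℂ), ?_, ?_⟩
  · have hexp : (((q : ℝ) / p : ℝ) : ℂ) * p = q := by push_cast; field_simp
    rw [IsImage] at h ⊢
    rw [mul_pow, ← h, ← Complex.cpow_mul_nat, hexp, Complex.cpow_natCast, ← mul_pow]
    ring
  · rw [← mul_sub_one, norm_mul]
    refine (mul_le_mul_of_nonneg_left hpow h₀'.le).trans (le_of_eq ?_)
    rw [Real.exp_neg, ← h.norm_deriv hp hq h₀]
    simp only [norm_div, norm_mul, Complex.norm_natCast]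
    field_simp

theorem IsImage.exists_isImage_norm_sub_le_exp {y₀ y₁ w : ℂ} {a δ : ℝ} (hq : q ≠ 0) (hpq : q ≤ p)
    (h : IsImage p q c y₀ y₁) (h₀ : y₀ ≠ 0) (ha : 0 < a) (hy₁ : a ≤ ‖y₁ - c‖) (hδ : δ ≤ 1)
    (hw : ‖w - y₁‖ ≤ a / 2 * δ) :
    ∃ x, IsImage p q c x w ∧ ‖x - y₀‖ ≤ Real.exp (δ - logExpansion p q y₀) * ‖w - y₁‖ := by
  obtain ⟨x, hx, hxy⟩ := h.exists_isImage_norm_sub_le hq hpq h₀ (w := w) (by nlinarith)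
  refine ⟨x, hx, hxy.trans ?_⟩
  have hrel : 2 / ‖y₁ - c‖ * ‖w - y₁‖ ≤ δ :=
    calc 2 / ‖y₁ - c‖ * ‖w - y₁‖ ≤ 2 / a * (a / 2 * δ) := by gcongr
      _ = δ := by field_simp
  rw [show δ - logExpansion p q y₀ = -logExpansion p q y₀ + δ by ring, Real.exp_add]
  gcongr
  linarith [Real.add_one_le_exp δ]

end Derivative

section Repeller

variable {p q : ℕ} {c : ℂ} {Λ : Set ℂ}

theorem shift_mem_orbitSpace {u : ℕ → ℂ} (hu : u ∈ orbitSpace p q c Λ) (n : ℕ) :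
    (fun i => u (n + i)) ∈ orbitSpace p q c Λ :=
  fun i => hu (n + i)

theorem isFiniteOrbit_of_mem_orbitSpace {u : ℕ → ℂ} (hu : u ∈ orbitSpace p q c Λ) (n : ℕ) :
    IsFiniteOrbit p q c n u :=
  fun i _ => (hu i).2

namespace IsHyperbolicRepeller

theorem ne_zero (h : IsHyperbolicRepeller p q c Λ) {z : ℂ} (hz : z ∈ Λ) : z ≠ 0 :=
  ne_of_mem_of_not_mem hz h.zero_notMem

theorem mem_of_isImage (h : IsHyperbolicRepeller p q c Λ) {z w : ℂ} (hzw : IsImage p q c z w)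
    (hw : w ∈ Λ) : z ∈ Λ :=
  h.preimage_eq.subset ⟨w, hw, hzw⟩

theorem exists_isImage_mem (h : IsHyperbolicRepeller p q c Λ) {z : ℂ} (hz : z ∈ Λ) :
    ∃ w ∈ Λ, IsImage p q c z w :=
  h.preimage_eq.superset hz

theorem criticalValue_notMem (h : IsHyperbolicRepeller p q c Λ) (hp : p ≠ 0) (hq : q ≠ 0) :
    c ∉ Λ := fun hc =>
  h.zero_notMem (h.mem_of_isImage (w := c) (by simp [IsImage, hp, hq]) hc)

theorem mem_of_isFiniteOrbit (h : IsHyperbolicRepeller p q c Λ) {n : ℕ} {z : ℕ → ℂ}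
    (hz : IsFiniteOrbit p q c n z) (hn : z n ∈ Λ) {i : ℕ} (hi : i ≤ n) : z i ∈ Λ := by
  induction n, hi using Nat.le_induction with
  | base => exact hn
  | succ n _ ih => exact ih (hz.mono n.le_succ) (h.mem_of_isImage (hz n n.lt_succ_self) hn)

theorem exists_mem_orbitSpace (h : IsHyperbolicRepeller p q c Λ) {z : ℂ} (hz : z ∈ Λ) :
    ∃ u ∈ orbitSpace p q c Λ, u 0 = z := by
  choose! g hgΛ hg using fun z (hz : z ∈ Λ) => h.exists_isImage_mem hz
  have hmem : ∀ i, g^[i] z ∈ Λ := fun i => Set.MapsTo.iterate hgΛ i hz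
  refine ⟨fun i => g^[i] z, fun i => ⟨hmem i, ?_⟩, rfl⟩
  simp only [Function.iterate_succ_apply']
  exact hg _ (hmem i)

theorem exists_mem_orbitSpace_extending (h : IsHyperbolicRepeller p q c Λ) {n : ℕ} {z : ℕ → ℂ}
    (hz : IsFiniteOrbit p q c n z) (hn : z n ∈ Λ) :
    ∃ u ∈ orbitSpace p q c Λ, ∀ i ≤ n, u i = z i := by
  obtain ⟨v, hv, hv0⟩ := h.exists_mem_orbitSpace hn
  have hglue : ∀ m, IsFiniteOrbit p q c (n + m) (glue n z v) := fun m =>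
    hz.glue (isFiniteOrbit_of_mem_orbitSpace hv m) hv0.symm
  refine ⟨glue n z v, fun i => ⟨?_, hglue (i + 1) i (by omega)⟩, fun i hi => glue_of_le hi _ _⟩
  refine h.mem_of_isFiniteOrbit (hglue i) ?_ (Nat.le_add_left i n)
  rw [glue_add hv0.symm]
  exact (hv i).1

theorem exists_le_norm (h : IsHyperbolicRepeller p q c Λ) (hp : p ≠ 0) (hq : q ≠ 0) :
    ∃ a > (0 : ℝ), ∀ z ∈ Λ, a ≤ ‖z‖ ∧ a ≤ ‖z - c‖ := by
  have exists_le_dist : ∀ u ∉ Λ, ∃ a > (0 : ℝ), ∀ z ∈ Λ, a ≤ ‖z - u‖ := by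
    intro u hu
    obtain ⟨a, ha, hball⟩ := Metric.isOpen_iff.1 h.isCompact.isClosed.isOpen_compl u hu
    exact ⟨a, ha, fun z hz => not_lt.1 fun hlt => hball (mem_ball_iff_norm.2 hlt) hz⟩
  obtain ⟨a, ha, h0⟩ := exists_le_dist 0 h.zero_notMem
  obtain ⟨b, hb, hc⟩ := exists_le_dist c (h.criticalValue_notMem hp hq)
  refine ⟨min a b, lt_min ha hb, fun z hz => ⟨?_, (min_le_right _ _).trans (hc z hz)⟩⟩
  simpa using (min_le_left a b).trans (h0 z hz)

theorem exists_le_logExpansionSum (h : IsHyperbolicRepeller p q c Λ) (hp : p ≠ 0) (hq : q ≠ 0) :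
    ∃ κ : ℝ, ∃ l > (0 : ℝ), ∀ (n : ℕ) (z : ℕ → ℂ), IsFiniteOrbit p q c n z → z n ∈ Λ →
      n * l - κ ≤ logExpansionSum p q z n := by
  obtain ⟨C, hC, l, hl, hexp⟩ := h.expanding
  refine ⟨-Real.log C, Real.log l, Real.log_pos hl, fun n z hz hn => ?_⟩
  have hmem : ∀ i ≤ n, z i ∈ Λ := fun i hi => h.mem_of_isFiniteOrbit hz hn hi
  have hderiv := hexp n z hz hmem
  rw [hz.norm_deriv_orbitBranch hp hq fun i hi => h.ne_zero (hmem i hi.le),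
    ← Real.log_le_iff_le_exp (by positivity), Real.log_mul hC.ne' (by positivity),
    Real.log_pow] at hderiv
  linarith

end IsHyperbolicRepeller

end Repeller

section Pullbacks

variable {p q : ℕ} {c : ℂ} {Λ : Set ℂ}

/-- Finite orbits ending in `Λ` can be pulled back from every point `w` at distance at most `r`
from their end, the pull-back approaching the orbit exponentially fast backwards in time. The last
bound in `exists_pullback` compares the contraction over the whole orbit with the derivative. -/
structure HasContractingPullbacks (p q : ℕ) (c : ℂ) (Λ : Set ℂ) (r K θ : ℝ) : Prop where
  r_pos : 0 < r
  K_pos : 0 < K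
  θ_pos : 0 < θ
  θ_lt_one : θ < 1
  exists_pullback : ∀ {n : ℕ} {z : ℕ → ℂ}, IsFiniteOrbit p q c n z → z n ∈ Λ →
    ∀ {w : ℂ}, ‖w - z n‖ ≤ r → ∃ x, IsFiniteOrbit p q c n x ∧ x n = w ∧
      (∀ i ≤ n, ‖x i - z i‖ ≤ K * θ ^ (n - i) * ‖w - z n‖) ∧
      ‖x 0 - z 0‖ ≤ K * Real.exp (-logExpansionSum p q z n) * ‖w - z n‖

namespace IsHyperbolicRepeller

/-- The distortion of the `i`-th inverse branch, counted from the end, is at most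
`exp ((1 - θ) θ ^ i)` with `θ = exp (-l)`; the product of the first `n` of these bounds is
`exp (1 - θ ^ n)`. -/
theorem exists_pullback_norm_sub_le_exp (h : IsHyperbolicRepeller p q c Λ) (hq : q ≠ 0)
    (hpq : q ≤ p) {a κ l : ℝ} (ha : 0 < a) (hlow : ∀ z ∈ Λ, a ≤ ‖z - c‖) (hl : 0 < l)
    (hexp : ∀ (n : ℕ) (z : ℕ → ℂ), IsFiniteOrbit p q c n z → z n ∈ Λ →
      n * l - κ ≤ logExpansionSum p q z n)
    {n : ℕ} {z : ℕ → ℂ} (hz : IsFiniteOrbit p q c n z) (hn : z n ∈ Λ) {w : ℂ}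
    (hw : ‖w - z n‖ ≤ a / 2 * (1 - Real.exp (-l)) * Real.exp (-(κ + 1))) :
    ∃ x, IsFiniteOrbit p q c n x ∧ x n = w ∧ ∀ i ≤ n, ‖x i - z i‖ ≤
      Real.exp (1 - Real.exp (-l) ^ (n - i) -
        (logExpansionSum p q z n - logExpansionSum p q z i)) * ‖w - z n‖ := by
  have hθ : Real.exp (-l) < 1 := Real.exp_lt_one_iff.2 (by linarith)
  set θ := Real.exp (-l) with hθ_def
  have hθ0 : 0 < θ := Real.exp_pos _
  induction n generalizing z with
  | zero =>
    refine ⟨fun _ => w, fun i hi => absurd hi i.not_lt_zero, rfl, fun i hi => ?_⟩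
    simp [Nat.le_zero.1 hi]
  | succ n ih =>
    obtain ⟨x, hx, hxn, hxz⟩ := ih hz.tail hn hw
    have hx0 : ‖x 0 - z 1‖ ≤
        Real.exp (1 - θ ^ n - logExpansionSum p q (fun i => z (i + 1)) n) * ‖w - z (n + 1)‖ := by
      simpa only [logExpansionSum_zero, Nat.sub_zero, sub_zero, zero_add] using hxz 0 n.zero_le
    have hclose : ‖x 0 - z 1‖ ≤ a / 2 * ((1 - θ) * θ ^ n) := by
      refine hx0.trans ((mul_le_mul (Real.exp_le_exp.2 ?_) hw (norm_nonneg _)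
        (Real.exp_nonneg (κ + 1 - n * l))).trans (le_of_eq ?_))
      · linarith [pow_pos hθ0 n, hexp n _ hz.tail hn]
      · rw [hθ_def, ← Real.exp_nat_mul, sub_eq_add_neg, Real.exp_add, mul_neg, Real.exp_neg (κ + 1)]
        field_simp
    obtain ⟨x₀, hx₀, hx₀z⟩ := (hz 0 n.succ_pos).exists_isImage_norm_sub_le_exp hq hpq
      (h.ne_zero (h.mem_of_isFiniteOrbit hz hn (Nat.zero_le _))) ha
      (hlow _ (h.mem_of_isFiniteOrbit hz hn (by omega)))
      (mul_le_one₀ (by linarith) (by positivity) (pow_le_one₀ hθ0.le hθ.le)) hclose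
    refine ⟨_, hx.cons hx₀, hxn, fun i hi => ?_⟩
    cases i with
    | zero =>
      calc ‖x₀ - z 0‖ ≤ _ := hx₀z
        _ ≤ Real.exp ((1 - θ) * θ ^ n - logExpansion p q (z 0)) * (Real.exp (1 - θ ^ n -
            logExpansionSum p q (fun i => z (i + 1)) n) * ‖w - z (n + 1)‖) := by gcongr
        _ = _ := by
          rw [← mul_assoc, ← Real.exp_add, logExpansionSum_succ', logExpansionSum_zero,
            Nat.sub_zero, pow_succ]
          congr 2
          ring
    | succ i =>
      rw [logExpansionSum_succ', logExpansionSum_succ', add_sub_add_left_eq_sub,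
        Nat.add_sub_add_right]
      exact hxz i (by omega)

theorem exists_hasContractingPullbacks (h : IsHyperbolicRepeller p q c Λ) (hq : q ≠ 0)
    (hpq : q ≤ p) : ∃ r K θ, HasContractingPullbacks p q c Λ r K θ := by
  have hp : p ≠ 0 := by omega
  obtain ⟨a, ha, hlow⟩ := h.exists_le_norm hp hq
  obtain ⟨κ, l, hl, hexp⟩ := h.exists_le_logExpansionSum hp hq
  have hθ : Real.exp (-l) < 1 := Real.exp_lt_one_iff.2 (by linarith)
  refine ⟨a / 2 * (1 - Real.exp (-l)) * Real.exp (-(κ + 1)), Real.exp (max κ 0 + 1),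
    Real.exp (-l), ⟨?_, Real.exp_pos _, Real.exp_pos _, hθ, fun {n z} hz hn w hw => ?_⟩⟩
  · have : 0 < 1 - Real.exp (-l) := by linarith
    positivity
  obtain ⟨x, hx, hxn, hxz⟩ := h.exists_pullback_norm_sub_le_exp hq hpq ha
    (fun z hz => (hlow z hz).2) hl hexp hz hn hw
  refine ⟨x, hx, hxn, fun i hi => (hxz i hi).trans ?_, (hxz 0 n.zero_le).trans ?_⟩
  · obtain ⟨m, rfl⟩ := Nat.exists_eq_add_of_le hi
    gcongr
    rw [Nat.add_sub_cancel_left, logExpansionSum_add, add_sub_cancel_left,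
      ← Real.exp_nat_mul, ← Real.exp_add, Real.exp_le_exp]
    linarith [hexp m _ hz.drop hn, Real.exp_pos (m * -l), le_max_left κ 0]
  · gcongr
    rw [← Real.exp_add, logExpansionSum_zero, Real.exp_le_exp]
    linarith [pow_pos (Real.exp_pos (-l)) (n - 0), le_max_right κ 0]

end IsHyperbolicRepeller

end Pullbacks

section Expansivity

variable {p q : ℕ} {c : ℂ} {Λ : Set ℂ}

theorem exists_eq_of_norm_sub_lt (hp : p ≠ 0) : ∃ κ > (0 : ℝ), ∀ {q : ℕ} {c : ℂ} {n : ℕ}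
    {x y : ℕ → ℂ}, IsFiniteOrbit p q c n x → IsFiniteOrbit p q c n y → x n = y n →
    (∀ i < n, ‖x i - y i‖ < κ * ‖y i‖) → ∀ i ≤ n, x i = y i := by
  obtain ⟨κ, hκ, hsep⟩ := exists_eq_of_pow_eq_of_norm_sub_lt (K := ℂ) hp
  refine ⟨κ, hκ, fun {q c n x y} hx hy hn hclose i hi => ?_⟩
  induction hi using Nat.decreasingInduction with
  | self => exact hn
  | of_succ i hi ih =>
    refine hsep _ _ ?_ (hclose i hi)
    rw [← hx i hi, ← hy i hi, ih]

theorem IsHyperbolicRepeller.exists_eq_of_norm_sub_lt (h : IsHyperbolicRepeller p q c Λ)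
    (hp : p ≠ 0) (hq : q ≠ 0) : ∃ δ > (0 : ℝ), ∀ {n : ℕ} {x y : ℕ → ℂ}, IsFiniteOrbit p q c n x →
      IsFiniteOrbit p q c n y → y n ∈ Λ → x n = y n → (∀ i < n, ‖x i - y i‖ < δ) →
      ∀ i ≤ n, x i = y i := by
  obtain ⟨κ, hκ, huniq⟩ := Corr.exists_eq_of_norm_sub_lt hp
  obtain ⟨a, ha, hlow⟩ := h.exists_le_norm hp hq
  refine ⟨κ * a, by positivity, fun hx hy hyn hn hclose => huniq hx hy hn fun i hi =>
    (hclose i hi).trans_le ?_⟩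
  gcongr
  exact (hlow _ (h.mem_of_isFiniteOrbit hy hyn hi.le)).1

end Expansivity

section Distortion

variable {p q : ℕ} {c : ℂ} {Λ : Set ℂ}

theorem abs_log_norm_sub_le {E : Type*} [NormedAddCommGroup E] {a : ℝ} (ha : 0 < a) {x y : E}
    (hx : a ≤ ‖x‖) (hy : a ≤ ‖y‖) : |Real.log ‖x‖ - Real.log ‖y‖| ≤ ‖x - y‖ / a := by
  have log_sub_le : ∀ u v : E, a ≤ ‖u‖ → a ≤ ‖v‖ →
      Real.log ‖u‖ - Real.log ‖v‖ ≤ ‖u - v‖ / a := by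
    intro u v hu hv
    have hu0 : 0 < ‖u‖ := ha.trans_le hu
    have hv0 : 0 < ‖v‖ := ha.trans_le hv
    calc Real.log ‖u‖ - Real.log ‖v‖ = Real.log (‖u‖ / ‖v‖) := (Real.log_div hu0.ne' hv0.ne').symm
      _ ≤ ‖u‖ / ‖v‖ - 1 := Real.log_le_sub_one_of_pos (by positivity)
      _ = (‖u‖ - ‖v‖) / ‖v‖ := div_sub_one hv0.ne'
      _ ≤ ‖u - v‖ / ‖v‖ := by gcongr; exact norm_sub_norm_le u v
      _ ≤ ‖u - v‖ / a := by gcongr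
  rw [abs_le']
  refine ⟨log_sub_le x y hx hy, ?_⟩
  rw [neg_sub, norm_sub_rev]
  exact log_sub_le y x hy hx

theorem abs_logExpansion_sub_le {a : ℝ} (ha : 0 < a) {x y : ℂ} (hx : a ≤ ‖x‖) (hy : a ≤ ‖y‖) :
    |logExpansion p q x - logExpansion p q y| ≤ |(p : ℝ) / q - 1| / a * ‖x - y‖ := by
  rw [logExpansion, logExpansion, add_sub_add_left_eq_sub, ← mul_sub, abs_mul,
    div_mul_eq_mul_div, mul_div_assoc]
  gcongr
  exact abs_log_norm_sub_le ha hx hy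

theorem abs_logExpansionSum_sub_le {a B θ : ℝ} (ha : 0 < a) (hB : 0 ≤ B) (hθ : 0 ≤ θ)
    (hθ1 : θ < 1) {n : ℕ} {x z : ℕ → ℂ} (hx : ∀ i < n, a ≤ ‖x i‖) (hz : ∀ i < n, a ≤ ‖z i‖)
    (hxz : ∀ i < n, ‖x i - z i‖ ≤ B * θ ^ (n - i)) :
    |logExpansionSum p q x n - logExpansionSum p q z n| ≤
      |(p : ℝ) / q - 1| / a * B * (1 - θ)⁻¹ := by
  rw [logExpansionSum, logExpansionSum, ← Finset.sum_sub_distrib]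
  calc |∑ i ∈ Finset.range n, (logExpansion p q (x i) - logExpansion p q (z i))|
    _ ≤ ∑ i ∈ Finset.range n, |logExpansion p q (x i) - logExpansion p q (z i)| :=
        Finset.abs_sum_le_sum_abs _ _
    _ ≤ ∑ i ∈ Finset.range n, |(p : ℝ) / q - 1| / a * B * θ ^ (n - 1 - i) := by
        refine Finset.sum_le_sum fun i hi => ?_
        have hi' := Finset.mem_range.1 hi
        refine (abs_logExpansion_sub_le ha (hx i hi') (hz i hi')).trans ?_
        rw [mul_assoc _ B]
        gcongr
        refine (hxz i hi').trans ?_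
        gcongr B * ?_
        exact pow_le_pow_of_le_one hθ hθ1.le (by omega)
    _ = |(p : ℝ) / q - 1| / a * B * ∑ i ∈ Finset.range n, θ ^ i := by
        rw [← Finset.mul_sum, Finset.sum_range_reflect (fun i => θ ^ i) n]
    _ ≤ |(p : ℝ) / q - 1| / a * B * (1 - θ)⁻¹ := by
        gcongr
        rw [← tsum_geometric_of_lt_one hθ hθ1]
        exact (summable_geometric_of_lt_one hθ hθ1).sum_le_tsum _ fun i _ => pow_nonneg hθ i

theorem abs_logExpansionSum_le {M : ℝ} {n : ℕ} {z : ℕ → ℂ}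
    (hM : ∀ i < n, |logExpansion p q (z i)| ≤ M) : |logExpansionSum p q z n| ≤ n * M :=
  calc |logExpansionSum p q z n| ≤ ∑ i ∈ Finset.range n, |logExpansion p q (z i)| :=
        Finset.abs_sum_le_sum_abs _ _
    _ ≤ ∑ _ ∈ Finset.range n, M :=
        Finset.sum_le_sum fun i hi => hM i (Finset.mem_range.1 hi)
    _ = n * M := by simp

namespace IsHyperbolicRepeller

theorem exists_abs_logExpansion_le (h : IsHyperbolicRepeller p q c Λ) :
    ∃ M ≥ (0 : ℝ), ∀ z ∈ Λ, |logExpansion p q z| ≤ M := by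
  have hcont : ContinuousOn (logExpansion p q) Λ := by
    unfold logExpansion
    exact continuousOn_const.add (continuousOn_const.mul (ContinuousOn.log
      continuous_norm.continuousOn fun z hz => norm_ne_zero_iff.2 (h.ne_zero hz)))
  obtain ⟨M, hM⟩ := h.isCompact.exists_bound_of_continuousOn hcont
  exact ⟨max M 0, le_max_right _ _, fun z hz => (hM z hz).trans (le_max_left _ _)⟩

theorem exists_abs_logExpansionSum_sub_le (h : IsHyperbolicRepeller p q c Λ) (hp : p ≠ 0)
    (hq : q ≠ 0) {B θ : ℝ} (hB : 0 ≤ B) (hθ : 0 ≤ θ) (hθ1 : θ < 1) :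
    ∃ k ≥ (0 : ℝ), ∀ {n : ℕ} {x z : ℕ → ℂ}, IsFiniteOrbit p q c n x → x n ∈ Λ →
      IsFiniteOrbit p q c n z → z n ∈ Λ → (∀ i < n, ‖x i - z i‖ ≤ B * θ ^ (n - i)) →
      |logExpansionSum p q x n - logExpansionSum p q z n| ≤ k := by
  obtain ⟨a, ha, hlow⟩ := h.exists_le_norm hp hq
  have : 0 < 1 - θ := sub_pos.2 hθ1
  exact ⟨|(p : ℝ) / q - 1| / a * B * (1 - θ)⁻¹, by positivity, fun hx hxn hz hzn hxz =>
    abs_logExpansionSum_sub_le ha hB hθ hθ1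
      (fun i hi => (hlow _ (h.mem_of_isFiniteOrbit hx hxn hi.le)).1)
      (fun i hi => (hlow _ (h.mem_of_isFiniteOrbit hz hzn hi.le)).1) hxz⟩

theorem exists_pullback_abs_logExpansionSum_sub_le (h : IsHyperbolicRepeller p q c Λ) (hq : q ≠ 0)
    (hpq : q ≤ p) {η : ℝ} (hη : 0 < η) :
    ∃ r > (0 : ℝ), ∃ k ≥ (0 : ℝ), ∀ {n : ℕ} {z : ℕ → ℂ}, IsFiniteOrbit p q c n z → z n ∈ Λ →
      ∀ {w : ℂ}, w ∈ Λ → ‖w - z n‖ ≤ r → ∃ x, IsFiniteOrbit p q c n x ∧ x n = w ∧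
        (∀ i ≤ n, ‖x i - z i‖ ≤ η) ∧ |logExpansionSum p q x n - logExpansionSum p q z n| ≤ k ∧
        ‖x 0 - z 0‖ ≤ Real.exp (k - logExpansionSum p q x n) := by
  obtain ⟨r, K, θ, hpull⟩ := h.exists_hasContractingPullbacks hq hpq
  have hr := hpull.r_pos
  have hK := hpull.K_pos
  obtain ⟨k, hk, hdist⟩ := h.exists_abs_logExpansionSum_sub_le (by omega) hq zero_le_one
    hpull.θ_pos.le hpull.θ_lt_one
  refine ⟨min r (min (η / K) (1 / K)), by positivity, k, hk, fun {n z} hz hn w hw hwz => ?_⟩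
  obtain ⟨hwr, hwη, hw1⟩ := (le_min_iff.1 hwz).imp_right le_min_iff.1
  rw [le_div_iff₀' hK] at hwη hw1
  obtain ⟨x, hx, hxn, hxz, hx0⟩ := hpull.exists_pullback hz hn hwr
  have hpow : ∀ i, θ ^ i ≤ 1 := fun i => pow_le_one₀ hpull.θ_pos.le hpull.θ_lt_one.le
  have hdist_xz : |logExpansionSum p q x n - logExpansionSum p q z n| ≤ k := by
    refine hdist hx (hxn ▸ hw) hz hn fun i hi => (hxz i hi.le).trans ?_
    rw [mul_right_comm]
    gcongr
    exact pow_nonneg hpull.θ_pos.le _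
  refine ⟨x, hx, hxn, fun i hi => (hxz i hi).trans ?_, hdist_xz, hx0.trans ?_⟩
  · rw [mul_right_comm]
    exact (mul_le_of_le_one_right (by positivity) (hpow _)).trans hwη
  · rw [mul_right_comm]
    refine (mul_le_of_le_one_left (Real.exp_pos _).le hw1).trans (Real.exp_le_exp.2 ?_)
    linarith [(abs_le.1 hdist_xz).2]

theorem exists_finset_pullback (h : IsHyperbolicRepeller p q c Λ) (hq : q ≠ 0) (hpq : q ≤ p) {η : ℝ}
    (hη : 0 < η) : ∃ T : Finset ℂ, ↑T ⊆ Λ ∧ ∃ k ≥ (0 : ℝ), ∀ {n : ℕ} {z : ℕ → ℂ},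
      IsFiniteOrbit p q c n z → z n ∈ Λ → ∃ x, IsFiniteOrbit p q c n x ∧ x n ∈ T ∧
        (∀ i ≤ n, ‖x i - z i‖ ≤ η) ∧ |logExpansionSum p q x n - logExpansionSum p q z n| ≤ k ∧
        ‖x 0 - z 0‖ ≤ Real.exp (k - logExpansionSum p q x n) := by
  obtain ⟨r, hr, k, hk, hpull⟩ := h.exists_pullback_abs_logExpansionSum_sub_le hq hpq hη
  obtain ⟨T, hTΛ, hTfin, hcover⟩ := h.isCompact.finite_cover_balls hr
  lift T to Finset ℂ using hTfin
  refine ⟨T, hTΛ, k, hk, fun {n z} hz hn => ?_⟩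
  obtain ⟨w, hw, hzw⟩ := Set.mem_iUnion₂.1 (hcover hn)
  obtain ⟨x, hx, hxn, hxz⟩ := hpull hz hn (hTΛ hw) (mem_ball_iff_norm'.1 hzw).le
  exact ⟨x, hx, hxn ▸ hw, hxz⟩

end IsHyperbolicRepeller

end Distortion

section Transfer

variable {p q : ℕ} {c : ℂ} {Λ : Set ℂ}

/-- The set of preimages of `w` under the correspondence (for `p ≠ 0`, see
`mem_preimageFinset`). -/
def preimageFinset (p q : ℕ) (c w : ℂ) : Finset ℂ := (Polynomial.nthRoots p ((w - c) ^ q)).toFinset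

theorem mem_preimageFinset {w v : ℂ} (hp : p ≠ 0) :
    v ∈ preimageFinset p q c w ↔ IsImage p q c v w := by
  rw [preimageFinset, Multiset.mem_toFinset, Polynomial.mem_nthRoots (Nat.pos_of_ne_zero hp),
    IsImage, eq_comm]

theorem card_preimageFinset_le (w : ℂ) : (preimageFinset p q c w).card ≤ p :=
  (Multiset.toFinset_card_le _).trans (Polynomial.card_nthRoots _ _)

theorem preimageFinset_nonempty (w : ℂ) (hp : p ≠ 0) : (preimageFinset p q c w).Nonempty := by
  obtain ⟨v, hv⟩ := IsAlgClosed.exists_pow_nat_eq ((w - c) ^ q) (Nat.pos_of_ne_zero hp)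
  exact ⟨v, (mem_preimageFinset hp).2 hv.symm⟩

theorem one_lt_card_preimageFinset {w : ℂ} (hp : 1 < p) (hw : w ≠ c) :
    1 < (preimageFinset p q c w).card := by
  have hp0 : p ≠ 0 := by omega
  obtain ⟨v, hv⟩ := preimageFinset_nonempty (q := q) (c := c) w hp0
  have hvw := (mem_preimageFinset hp0).1 hv
  have hv0 : v ≠ 0 := by
    rintro rfl
    rw [IsImage, zero_pow hp0] at hvw
    exact pow_ne_zero q (sub_ne_zero.2 hw) hvw
  obtain ⟨ζ, hζ⟩ : ∃ ζ : ℂ, IsPrimitiveRoot ζ p := ⟨_, Complex.isPrimitiveRoot_exp p hp0⟩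
  refine Finset.one_lt_card.2 ⟨v, hv, ζ * v, ?_, fun h => hζ.ne_one hp ?_⟩
  · rwa [mem_preimageFinset hp0, IsImage, mul_pow, hζ.pow_eq_one, one_mul]
  · exact mul_right_cancel₀ hv0 (by rw [one_mul, ← h])

/-- The injection `(x, a) ↦ cons a x`. -/
def consEmbedding {α : Type*} : (Σ _ : ℕ → α, α) ↪ (ℕ → α) where
  toFun a := cons a.2 a.1
  inj' _ _ hab := Sigma.ext (funext fun i => congrFun hab (i + 1)) (heq_of_eq (congrFun hab 0))

/-- The set of finite orbits of length `n` ending at `w`, each extended by the constant `w` beyond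
time `n` to make it unique as a sequence (for `p ≠ 0`, see `mem_backwardOrbits`). -/
def backwardOrbits (p q : ℕ) (c : ℂ) : ℕ → ℂ → Finset (ℕ → ℂ)
  | 0, w => {fun _ => w}
  | n + 1, w => ((backwardOrbits p q c n w).sigma fun y =>
      preimageFinset p q c (y 0)).map consEmbedding

theorem mem_backwardOrbits (hp : p ≠ 0) {n : ℕ} {w : ℂ} {y : ℕ → ℂ} :
    y ∈ backwardOrbits p q c n w ↔ IsFiniteOrbit p q c n y ∧ ∀ i ≥ n, y i = w := by
  induction n generalizing y with
  | zero =>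
    rw [backwardOrbits, Finset.mem_singleton]
    refine ⟨?_, fun h => funext fun i => h.2 i i.zero_le⟩
    rintro rfl
    exact ⟨fun i hi => absurd hi i.not_lt_zero, fun _ _ => rfl⟩
  | succ n ih =>
    simp only [backwardOrbits, Finset.mem_map, Finset.mem_sigma, ih, mem_preimageFinset hp]
    constructor
    · rintro ⟨⟨x, v⟩, ⟨⟨hx, hxw⟩, hv⟩, rfl⟩
      refine ⟨hx.cons hv, fun i hi => ?_⟩
      obtain ⟨j, rfl⟩ := Nat.exists_eq_add_of_le' (Nat.one_le_of_lt hi)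
      exact hxw j (by omega)
    · rintro ⟨hy, hyw⟩
      refine ⟨⟨fun i => y (i + 1), y 0⟩, ⟨⟨hy.tail, fun i hi => hyw _ (by omega)⟩,
        hy 0 n.succ_pos⟩, ?_⟩
      funext i
      cases i <;> rfl

theorem IsFiniteOrbit.min_mem_backwardOrbits (hp : p ≠ 0) {n : ℕ} {x : ℕ → ℂ}
    (hx : IsFiniteOrbit p q c n x) :
    (fun i => x (min i n)) ∈ backwardOrbits p q c n (x n) :=
  (mem_backwardOrbits hp).2
    ⟨hx.congr fun i hi => by rw [min_eq_left hi], fun i hi => by rw [min_eq_right hi]⟩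

theorem logExpansionSum_min (x : ℕ → ℂ) (n : ℕ) :
    logExpansionSum p q (fun i => x (min i n)) n = logExpansionSum p q x n :=
  logExpansionSum_congr fun i hi => by rw [min_eq_left hi.le]

/-- The Ruelle transfer operator of the potential `-s * logExpansion`. -/
def transferOperator (p q : ℕ) (c : ℂ) (s : ℝ) (φ : ℂ → ℝ) (w : ℂ) : ℝ :=
  ∑ v ∈ preimageFinset p q c w, Real.exp (-s * logExpansion p q v) * φ v

/-- The sum of `‖g'‖ ^ (-s)` over all branches `g` of the `n`-th iterate of the correspondence
ending at `w`; see `transferSum_eq_sum`. -/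
def transferSum (p q : ℕ) (c : ℂ) (s : ℝ) (n : ℕ) : ℂ → ℝ := (transferOperator p q c s)^[n] 1

theorem transferOperator_iterate_apply (s : ℝ) (n : ℕ) (φ : ℂ → ℝ) (w : ℂ) :
    (transferOperator p q c s)^[n] φ w =
      ∑ y ∈ backwardOrbits p q c n w, Real.exp (-s * logExpansionSum p q y n) * φ (y 0) := by
  induction n generalizing φ with
  | zero => simp [backwardOrbits, logExpansionSum]
  | succ n ih =>
    rw [Function.iterate_succ_apply, ih, backwardOrbits, Finset.sum_map, Finset.sum_sigma]
    refine Finset.sum_congr rfl fun y _ => ?_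
    rw [transferOperator, Finset.mul_sum]
    refine Finset.sum_congr rfl fun v _ => ?_
    calc Real.exp (-s * logExpansionSum p q y n) * (Real.exp (-s * logExpansion p q v) * φ v)
      _ = Real.exp (-s * (logExpansion p q v + logExpansionSum p q y n)) * φ v := by
          rw [mul_add, Real.exp_add]
          ring
      _ = Real.exp (-s * logExpansionSum p q (cons v y) (n + 1)) * φ (cons v y 0) := by
          rw [logExpansionSum_succ']
          rfl

theorem transferSum_eq_sum (s : ℝ) (n : ℕ) (w : ℂ) :
    transferSum p q c s n w =
      ∑ y ∈ backwardOrbits p q c n w, Real.exp (-s * logExpansionSum p q y n) := by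
  simp [transferSum, transferOperator_iterate_apply]

theorem transferSum_add_eq_sum (s : ℝ) (n m : ℕ) (w : ℂ) :
    transferSum p q c s (n + m) w = ∑ y ∈ backwardOrbits p q c n w,
      Real.exp (-s * logExpansionSum p q y n) * transferSum p q c s m (y 0) := by
  rw [transferSum, Function.iterate_add_apply, transferOperator_iterate_apply, transferSum]

theorem transferSum_zero (s : ℝ) (w : ℂ) : transferSum p q c s 0 w = 1 := rfl

theorem transferSum_one (s : ℝ) (w : ℂ) : transferSum p q c s 1 w =
    ∑ v ∈ preimageFinset p q c w, Real.exp (-s * logExpansion p q v) := by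
  simp [transferSum, transferOperator]

theorem backwardOrbits_nonempty (hp : p ≠ 0) (n : ℕ) (w : ℂ) :
    (backwardOrbits p q c n w).Nonempty := by
  induction n with
  | zero => exact Finset.singleton_nonempty _
  | succ n ih =>
    obtain ⟨y, hy⟩ := ih
    obtain ⟨v, hv⟩ := preimageFinset_nonempty (q := q) (c := c) (y 0) hp
    exact Finset.map_nonempty.2 ⟨⟨y, v⟩, Finset.mem_sigma.2 ⟨hy, hv⟩⟩

theorem transferSum_pos (hp : p ≠ 0) (s : ℝ) (n : ℕ) (w : ℂ) : 0 < transferSum p q c s n w := by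
  rw [transferSum_eq_sum]
  exact Finset.sum_pos (fun _ _ => Real.exp_pos _) (backwardOrbits_nonempty hp n w)

theorem eq_of_mem_backwardOrbits (hp : p ≠ 0) {n : ℕ} {w : ℂ} {x y : ℕ → ℂ}
    (hx : x ∈ backwardOrbits p q c n w) (hy : y ∈ backwardOrbits p q c n w)
    (hxy : ∀ i ≤ n, x i = y i) : x = y := by
  funext i
  rcases le_total i n with hi | hi
  · exact hxy i hi
  · rw [((mem_backwardOrbits hp).1 hx).2 i hi, ((mem_backwardOrbits hp).1 hy).2 i hi]

theorem neg_mul_le_abs_mul_add {x y k : ℝ} (h : |x - y| ≤ k) (s : ℝ) :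
    -s * x ≤ |s| * k + -s * y := by
  have hle : -(s * (x - y)) ≤ |s| * k :=
    calc -(s * (x - y)) ≤ |s * (x - y)| := neg_le_abs _
      _ = |s| * |x - y| := abs_mul _ _
      _ ≤ |s| * k := by gcongr
  linarith

theorem sum_exp_le_mul_transferSum (hp : p ≠ 0) (s : ℝ) {n : ℕ} {w : ℂ} {k : ℝ} {α : Type*}
    {E : Finset α} {y Y : α → ℕ → ℂ} (hY : ∀ a ∈ E, IsFiniteOrbit p q c n (Y a))
    (hYn : ∀ a ∈ E, Y a n = w)
    (hYy : ∀ a ∈ E, |logExpansionSum p q (Y a) n - logExpansionSum p q (y a) n| ≤ k)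
    (hinj : ∀ a ∈ E, ∀ b ∈ E, (∀ i ≤ n, Y a i = Y b i) → a = b) :
    ∑ a ∈ E, Real.exp (-s * logExpansionSum p q (y a) n) ≤
      Real.exp (|s| * k) * transferSum p q c s n w := by
  classical
  have hinjOn : Set.InjOn (fun a i => Y a (min i n)) E := by
    intro a ha b hb hab
    refine hinj a ha b hb fun i hi => ?_
    simpa [min_eq_left hi] using congrFun hab i
  calc ∑ a ∈ E, Real.exp (-s * logExpansionSum p q (y a) n)
    _ ≤ ∑ a ∈ E, Real.exp (|s| * k) *
          Real.exp (-s * logExpansionSum p q (fun i => Y a (min i n)) n) := by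
        gcongr with a ha
        rw [logExpansionSum_min, ← Real.exp_add, Real.exp_le_exp]
        refine neg_mul_le_abs_mul_add ?_ s
        rw [abs_sub_comm]
        exact hYy a ha
    _ = Real.exp (|s| * k) * ∑ x ∈ E.image fun a i => Y a (min i n),
          Real.exp (-s * logExpansionSum p q x n) := by
        rw [Finset.sum_image hinjOn, Finset.mul_sum]
    _ ≤ Real.exp (|s| * k) * transferSum p q c s n w := by
        rw [transferSum_eq_sum]
        gcongr
        exact Finset.image_subset_iff.2 fun a ha => hYn a ha ▸ (hY a ha).min_mem_backwardOrbits hp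

theorem sum_exp_le_mul_sum_transferSum (hp : p ≠ 0) (s : ℝ) {n : ℕ} {T : Finset ℂ} {k : ℝ}
    {α : Type*} {E : Finset α} {y Y : α → ℕ → ℂ} (hY : ∀ a ∈ E, IsFiniteOrbit p q c n (Y a))
    (hYT : ∀ a ∈ E, Y a n ∈ T)
    (hYy : ∀ a ∈ E, |logExpansionSum p q (Y a) n - logExpansionSum p q (y a) n| ≤ k)
    (hinj : ∀ a ∈ E, ∀ b ∈ E, (∀ i ≤ n, Y a i = Y b i) → a = b) :
    ∑ a ∈ E, Real.exp (-s * logExpansionSum p q (y a) n) ≤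
      Real.exp (|s| * k) * ∑ w ∈ T, transferSum p q c s n w := by
  rw [← Finset.sum_fiberwise_of_maps_to hYT, Finset.mul_sum]
  refine Finset.sum_le_sum fun w _ => ?_
  have hfilter : ∀ a ∈ E.filter (Y · n = w), a ∈ E ∧ Y a n = w := fun a => Finset.mem_filter.1
  exact sum_exp_le_mul_transferSum hp s (fun a ha => hY a (hfilter a ha).1)
    (fun a ha => (hfilter a ha).2) (fun a ha => hYy a (hfilter a ha).1)
    fun a ha b hb => hinj a (hfilter a ha).1 b (hfilter b hb).1

theorem exp_mul_transferSum_le (hp : p ≠ 0) (s : ℝ) (n : ℕ) {m : ℕ} {x : ℕ → ℂ}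
    (hx : IsFiniteOrbit p q c m x) :
    Real.exp (-s * logExpansionSum p q x m) * transferSum p q c s n (x 0) ≤
      transferSum p q c s (m + n) (x m) := by
  rw [transferSum_add_eq_sum, ← logExpansionSum_min]
  refine le_of_eq_of_le ?_ (Finset.single_le_sum (fun y _ =>
    (mul_pos (Real.exp_pos _) (transferSum_pos hp s n _)).le) (hx.min_mem_backwardOrbits hp))
  simp

end Transfer

section Growth

variable {p q : ℕ} {c : ℂ} {Λ : Set ℂ}

theorem le_of_forall_nat_mul_le {x y k : ℝ} (h : ∀ n : ℕ, n * x ≤ n * y + k) : x ≤ y := by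
  by_contra! hlt
  obtain ⟨n, hn⟩ := exists_nat_gt (k / (x - y))
  rw [div_lt_iff₀ (sub_pos.2 hlt)] at hn
  linarith [h n]

theorem exists_abs_sub_nat_mul_le {a : ℕ → ℝ} {k : ℝ}
    (h : ∀ m n, |a (m + n) - a m - a n| ≤ k) : ∃ P : ℝ, ∀ n : ℕ, |a n - n * P| ≤ k := by
  have h0 : |a 0| ≤ k := by simpa using h 0 0
  have hk : 0 ≤ k := (abs_nonneg _).trans h0
  have hlin : ∀ n : ℕ, |a (n + 1)| ≤ (n + 1 : ℕ) * (|a 1| + k) := by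
    intro n
    induction n with
    | zero => simpa using hk
    | succ n ih =>
      have hstep : |a (n + 1 + 1)| ≤ |a (n + 1)| + |a 1| + k := by
        have := abs_add_three (a (n + 1 + 1) - a (n + 1) - a 1) (a (n + 1)) (a 1)
        rw [sub_sub, add_assoc, sub_add_cancel, ← sub_sub] at this
        linarith [h (n + 1) 1]
      push_cast at ih ⊢
      linarith
  have hdiv : ∀ n : ℕ, |a n / n| ≤ |a 1| + k := by
    rintro (_ | n)
    · simpa using add_nonneg (abs_nonneg _) hk
    · rw [abs_div, Nat.abs_cast, div_le_iff₀' (by positivity)]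
      exact hlin n
  have hupper : Subadditive fun n => k + a n := fun m n => by linarith [(abs_le.1 (h m n)).2]
  have hlower : Subadditive fun n => k - a n := fun m n => by linarith [(abs_le.1 (h m n)).1]
  have hkn : ∀ n : ℕ, 0 ≤ k / n := fun n => by positivity
  have hbdd_upper : BddBelow (Set.range fun n : ℕ => (k + a n) / n) :=
    ⟨-(|a 1| + k), Set.forall_mem_range.2 fun n => by
      rw [add_div]; linarith [(abs_le.1 (hdiv n)).1, hkn n]⟩
  have hbdd_lower : BddBelow (Set.range fun n : ℕ => (k - a n) / n) :=
    ⟨-(|a 1| + k), Set.forall_mem_range.2 fun n => by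
      rw [sub_div]; linarith [(abs_le.1 (hdiv n)).2, hkn n]⟩
  have hlim : hupper.lim + hlower.lim = 0 :=
    tendsto_nhds_unique ((hupper.tendsto_lim hbdd_upper).add (hlower.tendsto_lim hbdd_lower))
      ((tendsto_const_div_atTop_nhds_zero_nat (2 * k)).congr fun n => by ring)
  refine ⟨hupper.lim, fun n => ?_⟩
  rcases Nat.eq_zero_or_pos n with rfl | hn
  · simpa using h0
  · have hle_upper := hupper.lim_le_div hbdd_upper hn.ne'
    have hle_lower := hlower.lim_le_div hbdd_lower hn.ne'
    rw [le_div_iff₀' (by positivity)] at hle_upper hle_lower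
    rw [eq_neg_of_add_eq_zero_right hlim] at hle_lower
    rw [abs_le]
    constructor <;> linarith

theorem IsLEO.exists_uniform (h : IsLEO p q c Λ) (hΛ : IsCompact Λ) {r : ℝ} (hr : 0 < r) :
    ∃ N : ℕ, ∀ w ∈ Λ, ∀ w' ∈ Λ, ∃ m ≤ N, ∃ x, IsFiniteOrbit p q c m x ∧ x 0 ∈ Λ ∧
      ‖x 0 - w‖ ≤ r ∧ x m = w' := by
  have hcover : ∀ u, ∃ m, u ∈ Λ → Λ ⊆ (imageSet p q c)^[m] (Metric.ball u (r / 2) ∩ Λ) := by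
    intro u
    by_cases hu : u ∈ Λ
    · obtain ⟨m, -, hm⟩ := h _ Metric.isOpen_ball ⟨u, Metric.mem_ball_self (half_pos hr), hu⟩
      exact ⟨m, fun _ => hm⟩
    · exact ⟨0, fun hu' => absurd hu' hu⟩
  choose m hm using hcover
  obtain ⟨t, htΛ, ht, hΛt⟩ := hΛ.finite_cover_balls (half_pos hr)
  refine ⟨ht.toFinset.sup m, fun w hw w' hw' => ?_⟩
  obtain ⟨u, hu, hwu⟩ := Set.mem_iUnion₂.1 (hΛt hw)
  obtain ⟨x, hx, hx0, hxm⟩ := mem_iterate_imageSet.1 (hm u (htΛ hu) hw')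
  refine ⟨m u, Finset.le_sup (f := m) (ht.mem_toFinset.2 hu), x, hx, hx0.2, ?_, hxm⟩
  rw [← dist_eq_norm]
  linarith [Metric.mem_ball.1 hx0.1, Metric.mem_ball.1 hwu, dist_triangle_right (x 0) w u]

namespace IsHyperbolicRepeller

theorem mem_of_mem_backwardOrbits (h : IsHyperbolicRepeller p q c Λ) (hp : p ≠ 0) {n : ℕ} {w : ℂ}
    (hw : w ∈ Λ) {y : ℕ → ℂ} (hy : y ∈ backwardOrbits p q c n w) {i : ℕ} (hi : i ≤ n) :
    y i ∈ Λ := by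
  obtain ⟨hy, hyw⟩ := (mem_backwardOrbits hp).1 hy
  exact h.mem_of_isFiniteOrbit hy ((hyw n le_rfl).symm ▸ hw) hi

theorem transferSum_add_le (h : IsHyperbolicRepeller p q c Λ) (hp : p ≠ 0) {s B : ℝ} {m : ℕ}
    (hB : ∀ v ∈ Λ, transferSum p q c s m v ≤ B) (n : ℕ) {w : ℂ} (hw : w ∈ Λ) :
    transferSum p q c s (n + m) w ≤ transferSum p q c s n w * B := by
  rw [transferSum_add_eq_sum, transferSum_eq_sum, Finset.sum_mul]
  gcongr with y hy
  exact hB _ (h.mem_of_mem_backwardOrbits hp hw hy n.zero_le)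

theorem le_transferSum_add (h : IsHyperbolicRepeller p q c Λ) (hp : p ≠ 0) {s B : ℝ} {m : ℕ}
    (hB : ∀ v ∈ Λ, B ≤ transferSum p q c s m v) (n : ℕ) {w : ℂ} (hw : w ∈ Λ) :
    transferSum p q c s n w * B ≤ transferSum p q c s (n + m) w := by
  rw [transferSum_add_eq_sum, transferSum_eq_sum, Finset.sum_mul]
  gcongr with y hy
  exact hB _ (h.mem_of_mem_backwardOrbits hp hw hy n.zero_le)

theorem transferSum_le_pow (h : IsHyperbolicRepeller p q c Λ) (hp : p ≠ 0) {s B : ℝ}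
    (hB : ∀ v ∈ Λ, transferSum p q c s 1 v ≤ B) (n : ℕ) {w : ℂ} (hw : w ∈ Λ) :
    transferSum p q c s n w ≤ B ^ n := by
  have hB0 : 0 ≤ B := (transferSum_pos hp s 1 w).le.trans (hB w hw)
  induction n with
  | zero => rw [transferSum_zero, pow_zero]
  | succ n ih =>
    refine (h.transferSum_add_le hp hB n hw).trans ?_
    rw [pow_succ]
    gcongr

theorem pow_le_transferSum (h : IsHyperbolicRepeller p q c Λ) (hp : p ≠ 0) {s B : ℝ}
    (hB0 : 0 ≤ B) (hB : ∀ v ∈ Λ, B ≤ transferSum p q c s 1 v) (n : ℕ) {w : ℂ} (hw : w ∈ Λ) :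
    B ^ n ≤ transferSum p q c s n w := by
  induction n with
  | zero => rw [transferSum_zero, pow_zero]
  | succ n ih =>
    refine le_trans ?_ (h.le_transferSum_add hp hB n hw)
    rw [pow_succ]
    gcongr

theorem exists_transferSum_one_le (h : IsHyperbolicRepeller p q c Λ) (hp : p ≠ 0) (s : ℝ) :
    ∃ B ≥ (1 : ℝ), ∀ w ∈ Λ, transferSum p q c s 1 w ≤ B := by
  obtain ⟨M, hM, hbound⟩ := h.exists_abs_logExpansion_le
  refine ⟨p * Real.exp (|s| * M), one_le_mul_of_one_le_of_one_le ?_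
    (Real.one_le_exp (by positivity)), fun w hw => ?_⟩
  · exact_mod_cast Nat.one_le_iff_ne_zero.2 hp
  calc transferSum p q c s 1 w
    _ = ∑ v ∈ preimageFinset p q c w, Real.exp (-s * logExpansion p q v) := transferSum_one s w
    _ ≤ ∑ _ ∈ preimageFinset p q c w, Real.exp (|s| * M) := by
        refine Finset.sum_le_sum fun v hv => Real.exp_le_exp.2 ?_
        have hv' := hbound v (h.mem_of_isImage ((mem_preimageFinset hp).1 hv) hw)
        rw [← sub_zero (logExpansion p q v)] at hv'
        simpa using neg_mul_le_abs_mul_add hv' s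
    _ = (preimageFinset p q c w).card * Real.exp (|s| * M) := by
        rw [Finset.sum_const, nsmul_eq_mul]
    _ ≤ p * Real.exp (|s| * M) := by
        gcongr
        exact card_preimageFinset_le w

theorem exists_transferSum_le_of_norm_sub_le (h : IsHyperbolicRepeller p q c Λ) (hq : q ≠ 0)
    (hpq : q ≤ p) : ∃ r > (0 : ℝ), ∃ k ≥ (0 : ℝ), ∀ s n, ∀ w ∈ Λ, ∀ w' ∈ Λ, ‖w' - w‖ ≤ r →
      transferSum p q c s n w ≤ Real.exp (|s| * k) * transferSum p q c s n w' := by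
  have hp : p ≠ 0 := by omega
  obtain ⟨δ, hδ, huniq⟩ := h.exists_eq_of_norm_sub_lt hp hq
  obtain ⟨r, hr, k, hk, hpull⟩ :=
    h.exists_pullback_abs_logExpansionSum_sub_le hq hpq (by positivity : 0 < δ / 4)
  refine ⟨r, hr, k, hk, fun s n w hw w' hw' hww => ?_⟩
  have horbit : ∀ y ∈ backwardOrbits p q c n w, IsFiniteOrbit p q c n y ∧ y n = w := fun y hy =>
    ⟨((mem_backwardOrbits hp).1 hy).1, ((mem_backwardOrbits hp).1 hy).2 n le_rfl⟩
  choose! Y hY hYn hclose hYy _ using fun y hy => hpull (horbit y hy).1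
    ((horbit y hy).2.symm ▸ hw) hw' (by rwa [(horbit y hy).2])
  rw [transferSum_eq_sum]
  refine sum_exp_le_mul_transferSum hp s hY hYn hYy fun x hx y hy hxy => ?_
  refine eq_of_mem_backwardOrbits hp hx hy (huniq (horbit x hx).1 (horbit y hy).1
    ((horbit y hy).2.symm ▸ hw) ((horbit x hx).2.trans (horbit y hy).2.symm) fun i hi => ?_)
  have hx_close := hclose x hx i hi.le
  have hy_close := hclose y hy i hi.le
  rw [norm_sub_rev, hxy i hi.le] at hx_close
  linarith [norm_sub_le_norm_sub_add_norm_sub (x i) (Y y i) (y i)]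

theorem exists_transferSum_le_mul (h : IsHyperbolicRepeller p q c Λ) (hLEO : IsLEO p q c Λ)
    (hq : q ≠ 0) (hpq : q ≤ p) (s : ℝ) : ∃ C ≥ (1 : ℝ), ∀ n, ∀ w ∈ Λ, ∀ w' ∈ Λ,
      transferSum p q c s n w ≤ C * transferSum p q c s n w' := by
  have hp : p ≠ 0 := by omega
  obtain ⟨r, hr, k, hk, hclose⟩ := h.exists_transferSum_le_of_norm_sub_le hq hpq
  obtain ⟨N, hN⟩ := hLEO.exists_uniform h.isCompact hr
  obtain ⟨M, hM, hbound⟩ := h.exists_abs_logExpansion_le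
  obtain ⟨B, hB, hB1⟩ := h.exists_transferSum_one_le hp s
  refine ⟨Real.exp (|s| * k) * (Real.exp (|s| * (N * M)) * B ^ N),
    one_le_mul_of_one_le_of_one_le (Real.one_le_exp (by positivity))
      (one_le_mul_of_one_le_of_one_le (Real.one_le_exp (by positivity)) (one_le_pow₀ hB)),
    fun n w hw w' hw' => ?_⟩
  obtain ⟨m, hm, x, hx, hx0, hxw, rfl⟩ := hN w hw w' hw'
  have hexp : 1 ≤ Real.exp (|s| * (N * M)) * Real.exp (-s * logExpansionSum p q x m) := by
    have hsum : |0 - logExpansionSum p q x m| ≤ N * M := by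
      rw [zero_sub, abs_neg]
      refine (abs_logExpansionSum_le fun i hi =>
        hbound _ (h.mem_of_isFiniteOrbit hx hw' hi.le)).trans ?_
      gcongr
    rw [← Real.exp_add, Real.one_le_exp_iff]
    simpa using neg_mul_le_abs_mul_add hsum s
  have hpos := (transferSum_pos (q := q) (c := c) hp s n (x 0)).le
  have _ := (transferSum_pos (q := q) (c := c) hp s n (x m)).le
  calc transferSum p q c s n w
    _ ≤ Real.exp (|s| * k) * transferSum p q c s n (x 0) := hclose s n w hw (x 0) hx0 hxw
    _ ≤ Real.exp (|s| * k) * (Real.exp (|s| * (N * M)) *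
          (Real.exp (-s * logExpansionSum p q x m) * transferSum p q c s n (x 0))) := by
        rw [← mul_assoc (Real.exp (|s| * (N * M)))]
        gcongr
        exact le_mul_of_one_le_left hpos hexp
    _ ≤ Real.exp (|s| * k) * (Real.exp (|s| * (N * M)) * transferSum p q c s (n + m) (x m)) := by
        rw [add_comm n]
        gcongr
        exact exp_mul_transferSum_le hp s n hx
    _ ≤ Real.exp (|s| * k) *
          (Real.exp (|s| * (N * M)) * (transferSum p q c s n (x m) * B ^ N)) := by
        gcongr
        exact h.transferSum_add_le hp (fun v hv => (h.transferSum_le_pow hp hB1 m hv).trans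
          (pow_le_pow_right₀ hB hm)) n hw'
    _ = Real.exp (|s| * k) * (Real.exp (|s| * (N * M)) * B ^ N) * transferSum p q c s n (x m) := by
        ring

end IsHyperbolicRepeller

end Growth

section GrowthRate

variable {p q : ℕ} {c : ℂ} {Λ : Set ℂ}

/-- `P` is the exponential growth rate of the transfer sums of exponent `s` over `Λ`, up to a
bounded factor. -/
def IsGrowthRate (p q : ℕ) (c : ℂ) (Λ : Set ℂ) (s P : ℝ) : Prop :=
  ∃ k : ℝ, ∀ n : ℕ, ∀ w ∈ Λ, Real.exp (n * P - k) ≤ transferSum p q c s n w ∧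
    transferSum p q c s n w ≤ Real.exp (n * P + k)

theorem le_add_of_forall_transferSum_le {s t P Q a b : ℝ} (hP : IsGrowthRate p q c Λ s P)
    (hQ : IsGrowthRate p q c Λ t Q) (hne : Λ.Nonempty)
    (h : ∀ n : ℕ, ∀ w ∈ Λ, transferSum p q c s n w ≤
      Real.exp (n * a + b) * transferSum p q c t n w) : P ≤ a + Q := by
  obtain ⟨w, hw⟩ := hne
  obtain ⟨k, hk⟩ := hP
  obtain ⟨k', hk'⟩ := hQ
  refine le_of_forall_nat_mul_le (k := b + k + k') fun n => ?_
  have hle : Real.exp (n * P - k) ≤ Real.exp (n * a + b) * Real.exp (n * Q + k') :=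
    calc Real.exp (n * P - k) ≤ transferSum p q c s n w := (hk n w hw).1
      _ ≤ Real.exp (n * a + b) * transferSum p q c t n w := h n w hw
      _ ≤ Real.exp (n * a + b) * Real.exp (n * Q + k') := by
          gcongr
          exact (hk' n w hw).2
  rw [← Real.exp_add, Real.exp_le_exp] at hle
  linarith

theorem transferSum_le_exp_mul {s t a : ℝ} {n : ℕ} {w : ℂ}
    (h : ∀ y ∈ backwardOrbits p q c n w,
      -s * logExpansionSum p q y n ≤ a + -t * logExpansionSum p q y n) :
    transferSum p q c s n w ≤ Real.exp a * transferSum p q c t n w := by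
  rw [transferSum_eq_sum, transferSum_eq_sum, Finset.mul_sum]
  gcongr with y hy
  rw [← Real.exp_add, Real.exp_le_exp]
  exact h y hy

namespace IsHyperbolicRepeller

theorem exists_isGrowthRate (h : IsHyperbolicRepeller p q c Λ) (hLEO : IsLEO p q c Λ)
    (hne : Λ.Nonempty) (hq : q ≠ 0) (hpq : q ≤ p) (s : ℝ) :
    ∃ P, IsGrowthRate p q c Λ s P := by
  have hp : p ≠ 0 := by omega
  obtain ⟨w₀, hw₀⟩ := hne
  obtain ⟨C, hC, hcomp⟩ := h.exists_transferSum_le_mul hLEO hq hpq s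
  have hC0 : 0 < C := by linarith
  have hpos : ∀ n w, 0 < transferSum p q c s n w := transferSum_pos hp s
  have hlog : ∀ n, ∀ w ∈ Λ, ∀ w' ∈ Λ, Real.log (transferSum p q c s n w) ≤
      Real.log C + Real.log (transferSum p q c s n w') := by
    intro n w hw w' hw'
    rw [← Real.log_mul hC0.ne' (hpos n w').ne']
    exact Real.log_le_log (hpos n w) (hcomp n w hw w' hw')
  have hadd : ∀ m n, |Real.log (transferSum p q c s (m + n) w₀) -
      Real.log (transferSum p q c s m w₀) - Real.log (transferSum p q c s n w₀)| ≤
        Real.log C := by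
    intro m n
    have hupper := Real.log_le_log (hpos _ _)
      (h.transferSum_add_le hp (fun v hv => hcomp n v hv w₀ hw₀) m hw₀)
    have hlower := Real.log_le_log (mul_pos (hpos m w₀) (mul_pos (inv_pos.2 hC0) (hpos n w₀)))
      (h.le_transferSum_add hp (fun v hv => (inv_mul_le_iff₀ hC0).2 (hcomp n w₀ hw₀ v hv)) m hw₀)
    rw [Real.log_mul (hpos m w₀).ne' (mul_pos hC0 (hpos n w₀)).ne',
      Real.log_mul hC0.ne' (hpos n w₀).ne'] at hupper
    rw [Real.log_mul (hpos m w₀).ne' (mul_pos (inv_pos.2 hC0) (hpos n w₀)).ne',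
      Real.log_mul (inv_pos.2 hC0).ne' (hpos n w₀).ne', Real.log_inv] at hlower
    rw [abs_le]
    constructor <;> linarith
  obtain ⟨P, hP⟩ :=
    exists_abs_sub_nat_mul_le (a := fun n => Real.log (transferSum p q c s n w₀)) hadd
  refine ⟨P, 2 * Real.log C, fun n w hw => ?_⟩
  have hPn := abs_le.1 (hP n)
  have hle := hlog n w hw w₀ hw₀
  have hge := hlog n w₀ hw₀ w hw
  rw [← Real.le_log_iff_exp_le (hpos n w), ← Real.log_le_iff_le_exp (hpos n w)]
  constructor <;> linarith

theorem exists_pos_mul_le_sub (h : IsHyperbolicRepeller p q c Λ) (hne : Λ.Nonempty)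
    (hp : p ≠ 0) (hq : q ≠ 0) {P : ℝ → ℝ} (hP : ∀ s, IsGrowthRate p q c Λ s (P s)) :
    ∃ l > (0 : ℝ), ∀ s t, s ≤ t → l * (t - s) ≤ P s - P t := by
  obtain ⟨κ, l, hl, hexp⟩ := h.exists_le_logExpansionSum hp hq
  refine ⟨l, hl, fun s t hst => ?_⟩
  have := le_add_of_forall_transferSum_le (a := -(l * (t - s))) (b := (t - s) * κ) (hP t) (hP s)
    hne fun n w hw => transferSum_le_exp_mul fun y hy => by
      have := hexp n y ((mem_backwardOrbits hp).1 hy).1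
        (h.mem_of_mem_backwardOrbits hp hw hy le_rfl)
      linarith [mul_le_mul_of_nonneg_left this (sub_nonneg.2 hst)]
  linarith

theorem exists_sub_le_mul (h : IsHyperbolicRepeller p q c Λ) (hne : Λ.Nonempty)
    (hp : p ≠ 0) {P : ℝ → ℝ} (hP : ∀ s, IsGrowthRate p q c Λ s (P s)) :
    ∃ M : ℝ, ∀ s t, s ≤ t → P s - P t ≤ M * (t - s) := by
  obtain ⟨M, -, hbound⟩ := h.exists_abs_logExpansion_le
  refine ⟨M, fun s t hst => ?_⟩
  have := le_add_of_forall_transferSum_le (a := M * (t - s)) (b := 0) (hP s) (hP t)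
    hne fun n w hw => transferSum_le_exp_mul fun y hy => by
      have := (le_abs_self _).trans (abs_logExpansionSum_le fun i (hi : i < n) =>
        hbound _ (h.mem_of_mem_backwardOrbits hp hw hy hi.le))
      linarith [mul_le_mul_of_nonneg_left this (sub_nonneg.2 hst)]
  linarith

theorem growthRate_zero_pos (h : IsHyperbolicRepeller p q c Λ) (hne : Λ.Nonempty)
    (hp : 1 < p) (hq : q ≠ 0) {P : ℝ} (hP : IsGrowthRate p q c Λ 0 P) : 0 < P := by
  have hp0 : p ≠ 0 := by omega
  obtain ⟨w, hw⟩ := hne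
  obtain ⟨k, hk⟩ := hP
  have htwo : ∀ v ∈ Λ, 2 ≤ transferSum p q c 0 1 v := by
    intro v hv
    have hcard : 2 ≤ (preimageFinset p q c v).card :=
      one_lt_card_preimageFinset hp fun hvc => h.criticalValue_notMem hp0 hq (hvc ▸ hv)
    rw [transferSum_one]
    simpa using hcard
  refine (Real.log_pos one_lt_two).trans_le (le_of_forall_nat_mul_le (k := k) fun n => ?_)
  rw [← Real.log_pow, Real.log_le_iff_le_exp (by positivity)]
  exact (h.pow_le_transferSum hp0 zero_le_two htwo n hw).trans (hk n w hw).2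

end IsHyperbolicRepeller

theorem exists_pos_forall_eq_zero_iff {f : ℝ → ℝ} {l M : ℝ} (hl : 0 < l) (h0 : 0 < f 0)
    (hlower : ∀ s t, s ≤ t → l * (t - s) ≤ f s - f t)
    (hupper : ∀ s t, s ≤ t → f s - f t ≤ M * (t - s)) : ∃ t > 0, ∀ s, f s = 0 ↔ s = t := by
  have hanti : StrictAnti f := fun s t hst =>
    sub_pos.1 ((mul_pos hl (sub_pos.2 hst)).trans_le (hlower s t hst.le))
  have hM : 0 ≤ M := by linarith [hlower 0 1 zero_le_one, hupper 0 1 zero_le_one]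
  have hcont : Continuous f := by
    refine (LipschitzWith.of_le_add_mul ⟨M, hM⟩ fun s t => ?_).continuous
    rcases le_total s t with hst | hst
    · rw [Real.dist_eq, abs_sub_comm, abs_of_nonneg (sub_nonneg.2 hst)]
      exact sub_le_iff_le_add'.1 (hupper s t hst)
    · exact (hanti.antitone hst).trans (le_add_of_nonneg_right (by positivity))
  have hneg : f (f 0 / l) ≤ 0 := by
    have := hlower 0 (f 0 / l) (by positivity)
    rw [sub_zero, mul_div_cancel₀ _ hl.ne'] at this
    linarith
  obtain ⟨t, ht, hft⟩ := intermediate_value_Icc' (by positivity : 0 ≤ f 0 / l)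
    hcont.continuousOn ⟨hneg, h0.le⟩
  refine ⟨t, ht.1.lt_of_ne (by rintro rfl; exact h0.ne' hft), fun s =>
    ⟨fun hs => hanti.injective (hs.trans hft.symm), fun hs => hs ▸ hft⟩⟩

theorem IsHyperbolicRepeller.exists_pos_forall_growthRate_eq_zero_iff
    (h : IsHyperbolicRepeller p q c Λ) (hne : Λ.Nonempty) (hq : q ≠ 0) (hpq : q < p) {P : ℝ → ℝ}
    (hP : ∀ s, IsGrowthRate p q c Λ s (P s)) : ∃ t > 0, ∀ s, P s = 0 ↔ s = t := by
  have hp : p ≠ 0 := by omega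
  obtain ⟨l, hl, hlower⟩ := h.exists_pos_mul_le_sub hne hp hq hP
  obtain ⟨M, hupper⟩ := h.exists_sub_le_mul hne hp hP
  exact exists_pos_forall_eq_zero_iff hl (h.growthRate_zero_pos hne (by omega) hq (hP 0))
    hlower hupper

end GrowthRate

section HausdorffMeasure

variable {p q : ℕ} {c : ℂ} {Λ : Set ℂ}

theorem hausdorffMeasure_lt_top_of_cover {X ι : Type*} [MetricSpace X] [MeasurableSpace X]
    [BorelSpace X] {A : Set X} {t B : ℝ} (ht : 0 ≤ t) {I : ℕ → Finset ι} {x : ℕ → ι → X}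
    {ρ : ℕ → ι → ℝ} {R : ℕ → ℝ} (hρ : ∀ n, ∀ a ∈ I n, 0 ≤ ρ n a ∧ ρ n a ≤ R n)
    (hR : Tendsto R atTop (𝓝 0)) (hcover : ∀ n, A ⊆ ⋃ a ∈ I n, Metric.closedBall (x n a) (ρ n a))
    (hsum : ∀ n, ∑ a ∈ I n, ρ n a ^ t ≤ B) : μH[t] A < ⊤ := by
  have hdiam : ∀ n, ∀ a ∈ I n, Metric.ediam (Metric.closedBall (x n a) (ρ n a)) ≤
      2 * ENNReal.ofReal (ρ n a) := fun n a ha => by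
    rw [← Metric.closedEBall_ofReal (hρ n a ha).1]
    exact Metric.ediam_closedEBall_le
  have hlim : Tendsto (fun n => 2 * ENNReal.ofReal (R n)) atTop (𝓝 0) := by
    simpa using ENNReal.Tendsto.const_mul (a := 2) (ENNReal.tendsto_ofReal hR) (by simp)
  have hsum_diam : ∀ n, ∑ a : I n, Metric.ediam (Metric.closedBall (x n a) (ρ n a)) ^ t ≤
      2 ^ t * ENNReal.ofReal B := fun n =>
    calc ∑ a : I n, Metric.ediam (Metric.closedBall (x n a) (ρ n a)) ^ t
      _ ≤ ∑ a : I n, 2 ^ t * ENNReal.ofReal (ρ n a ^ t) := by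
          refine Finset.sum_le_sum fun a _ => ?_
          rw [← ENNReal.ofReal_rpow_of_nonneg (hρ n a a.2).1 ht,
            ← ENNReal.mul_rpow_of_nonneg _ _ ht]
          exact ENNReal.rpow_le_rpow (hdiam n a a.2) ht
      _ = 2 ^ t * ENNReal.ofReal (∑ a ∈ I n, ρ n a ^ t) := by
          rw [ENNReal.ofReal_sum_of_nonneg fun a ha => Real.rpow_nonneg (hρ n a ha).1 t,
            Finset.mul_sum, Finset.sum_coe_sort (I n) fun a => 2 ^ t * ENNReal.ofReal (ρ n a ^ t)]
      _ ≤ 2 ^ t * ENNReal.ofReal B := by gcongr; exact hsum n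
  refine (Measure.hausdorffMeasure_le_liminf_sum t A _ hlim
    (fun n (a : I n) => Metric.closedBall (x n a) (ρ n a))
    (.of_forall fun n a => (hdiam n a a.2).trans (by gcongr; exact (hρ n a a.2).2))
    (.of_forall fun n => (hcover n).trans (by simp [Set.iUnion_subtype]))).trans_lt ?_
  exact (liminf_le_of_frequently_le' (.of_forall hsum_diam)).trans_lt
    (ENNReal.mul_lt_top (ENNReal.rpow_lt_top_of_nonneg ht (by simp)) ENNReal.ofReal_lt_top)

theorem IsHyperbolicRepeller.hausdorffMeasure_lt_top (h : IsHyperbolicRepeller p q c Λ)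
    (hq : q ≠ 0) (hpq : q ≤ p) {t B : ℝ} (ht : 0 ≤ t)
    (hB : ∀ n, ∀ w ∈ Λ, transferSum p q c t n w ≤ B) : μH[t] Λ < ⊤ := by
  have hp : p ≠ 0 := by omega
  obtain ⟨T, hTΛ, k, -, hpull⟩ := h.exists_finset_pullback hq hpq one_pos
  obtain ⟨κ, l, hl, hexp⟩ := h.exists_le_logExpansionSum hp hq
  have horbit : ∀ n, ∀ a ∈ T.sigma (backwardOrbits p q c n),
      IsFiniteOrbit p q c n a.2 ∧ a.2 n ∈ Λ := by
    rintro n ⟨w, y⟩ ha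
    obtain ⟨hw, hy⟩ := Finset.mem_sigma.1 ha
    obtain ⟨hy, hyn⟩ := (mem_backwardOrbits hp).1 hy
    exact ⟨hy, hyn n le_rfl ▸ hTΛ hw⟩
  refine hausdorffMeasure_lt_top_of_cover (B := T.card * (Real.exp (k * t) * B)) ht
    (I := fun n => T.sigma (backwardOrbits p q c n)) (x := fun _ a => a.2 0)
    (ρ := fun n a => Real.exp (k - logExpansionSum p q a.2 n))
    (R := fun n => Real.exp (k + κ - n * l)) (fun n a ha => ⟨(Real.exp_pos _).le, ?_⟩) ?_
    (fun n z hz => ?_) fun n => ?_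
  · rw [Real.exp_le_exp]
    linarith [hexp n _ (horbit n a ha).1 (horbit n a ha).2]
  · exact Real.tendsto_exp_atBot.comp (tendsto_const_nhds.add_atBot
      (tendsto_neg_atTop_atBot.comp (tendsto_natCast_atTop_atTop.atTop_mul_const hl)))
  · obtain ⟨u, hu, rfl⟩ := h.exists_mem_orbitSpace hz
    obtain ⟨x, hx, hxn, -, -, hx0⟩ := hpull (isFiniteOrbit_of_mem_orbitSpace hu n) (hu n).1
    refine Set.mem_iUnion₂.2 ⟨⟨x n, fun i => x (min i n)⟩,
      Finset.mem_sigma.2 ⟨hxn, hx.min_mem_backwardOrbits hp⟩, ?_⟩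
    rw [mem_closedBall_iff_norm', logExpansionSum_min]
    simpa using hx0
  · calc ∑ a ∈ T.sigma (backwardOrbits p q c n), Real.exp (k - logExpansionSum p q a.2 n) ^ t
      _ = ∑ w ∈ T, Real.exp (k * t) * transferSum p q c t n w := by
          rw [Finset.sum_sigma]
          refine Finset.sum_congr rfl fun w _ => ?_
          rw [transferSum_eq_sum, Finset.mul_sum]
          refine Finset.sum_congr rfl fun y _ => ?_
          rw [← Real.exp_mul, ← Real.exp_add]
          ring_nf
      _ ≤ ∑ _ ∈ T, Real.exp (k * t) * B := by
          gcongr with w hw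
          exact hB n w (hTΛ hw)
      _ = T.card * (Real.exp (k * t) * B) := by rw [Finset.sum_const, nsmul_eq_mul]

end HausdorffMeasure

section Pressure

theorem pressure_eq_of_exponential_growth {X : Type*} [MetricSpace X] {f : X → X} {A : Set X}
    {φ : X → ℝ} {P : ℝ}
    (hupper : ∀ ε > 0, ∃ C, ∀ n : ℕ,
      partitionSup f A φ n ε ≤ ENNReal.ofReal (Real.exp (n * P + C)))
    (hlower : ∃ ε > 0, ∃ C, ∀ n : ℕ,
      ENNReal.ofReal (Real.exp (n * P + C)) ≤ partitionSup f A φ n ε) :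
    pressure f A φ = (P : EReal) := by
  have hlim : ∀ C : ℝ, Tendsto (fun n : ℕ => ENNReal.log (ENNReal.ofReal (Real.exp (n * P + C))) /
      ((n : ℝ) : EReal)) atTop (𝓝 (P : EReal)) := by
    intro C
    have hreal : Tendsto (fun n : ℕ => P + C / n) atTop (𝓝 P) := by
      simpa using (tendsto_const_div_atTop_nhds_zero_nat C).const_add P
    refine ((continuous_coe_real_ereal.tendsto P).comp hreal).congr' ?_
    filter_upwards [eventually_gt_atTop 0] with n hn
    rw [ENNReal.log_ofReal_of_pos (Real.exp_pos _), Real.log_exp, ← EReal.coe_div,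
      Function.comp_apply]
    congr 1
    field_simp
  have hmono : ∀ n : ℕ, Monotone fun x : EReal => x / ((n : ℝ) : EReal) := fun n =>
    EReal.monotone_div_right_of_nonneg (by exact_mod_cast n.cast_nonneg (α := ℝ))
  refine le_antisymm (iSup₂_le fun ε hε => ?_) ?_
  · obtain ⟨C, hC⟩ := hupper ε hε
    rw [← (hlim C).limsup_eq]
    exact limsup_le_limsup (.of_forall fun n => hmono n (ENNReal.log_le_log (hC n)))
  · obtain ⟨ε, hε, C, hC⟩ := hlower
    refine le_trans ?_ (le_iSup₂ (f := fun (ε : ℝ) (_ : 0 < ε) => limsup (fun n : ℕ =>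
      ENNReal.log (partitionSup f A φ n ε) / ((n : ℝ) : EReal)) atTop) ε hε)
    rw [← (hlim C).limsup_eq]
    exact limsup_le_limsup (.of_forall fun n => hmono n (ENNReal.log_le_log (hC n)))

theorem projectedOrbit_iterate (f : ℂ × ℂ → ℂ × ℂ) (x : ℂ × ℂ) (j i : ℕ) :
    projectedOrbit f (f^[j] x) i = projectedOrbit f x (i + j) := by
  rw [projectedOrbit, projectedOrbit, Function.iterate_add_apply]

namespace IsC2Extension

variable {p q : ℕ} {c : ℂ} {V : Set (ℂ × ℂ)} {f : ℂ × ℂ → ℂ × ℂ}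

theorem mapsTo (h : IsC2Extension p q c V f) :
    Set.MapsTo f (closurePeriodicPts V f) (closurePeriodicPts V f) :=
  Set.mapsTo_iff_image_subset.2 h.image_eq.subset

theorem continuousOn_projectedOrbit (h : IsC2Extension p q c V f) :
    ContinuousOn (projectedOrbit f) (closurePeriodicPts V f) :=
  continuousOn_pi.2 fun i => continuous_fst.comp_continuousOn
    ((h.holomorphic.continuousOn.mono h.subset).iterate h.mapsTo i)

theorem exists_dist_le (h : IsC2Extension p q c V f) {ε : ℝ} (hε : 0 < ε) :
    ∃ N : ℕ, ∃ δ > (0 : ℝ), ∀ x ∈ closurePeriodicPts V f, ∀ y ∈ closurePeriodicPts V f,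
      (∀ i ≤ N, ‖projectedOrbit f x i - projectedOrbit f y i‖ < δ) → dist x y ≤ ε := by
  by_contra! hcon
  choose x hx y hy hclose hfar using fun n : ℕ =>
    hcon n (1 / ((n : ℝ) + 1)) Nat.one_div_pos_of_nat
  obtain ⟨⟨a, b⟩, ⟨ha, hb⟩, φ, hφ, hlim⟩ := (h.isCompact.prod h.isCompact).tendsto_subseq
    (x := fun n => (x n, y n)) fun n => ⟨hx n, hy n⟩
  have hxa : Tendsto (fun n => x (φ n)) atTop (𝓝 a) := (continuous_fst.tendsto _).comp hlim
  have hyb : Tendsto (fun n => y (φ n)) atTop (𝓝 b) := (continuous_snd.tendsto _).comp hlim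
  have hab : a = b := by
    have hlim_orbit : ∀ {u : ℕ → ℂ × ℂ} {e : ℂ × ℂ}, (∀ n, u n ∈ closurePeriodicPts V f) →
        e ∈ closurePeriodicPts V f → Tendsto u atTop (𝓝 e) → ∀ i,
        Tendsto (fun n => projectedOrbit f (u n) i) atTop (𝓝 (projectedOrbit f e i)) :=
      fun hu he hue => tendsto_pi_nhds.1 <| (h.continuousOn_projectedOrbit _ he).tendsto.comp
        (tendsto_nhdsWithin_iff.2 ⟨hue, .of_forall hu⟩)
    refine h.bijOn.injOn ha hb (funext fun i => ?_)
    refine eq_of_sub_eq_zero (tendsto_nhds_unique ((hlim_orbit (fun n => hx (φ n)) ha hxa i).sub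
      (hlim_orbit (fun n => hy (φ n)) hb hyb i)) ?_)
    refine squeeze_zero_norm' ?_ (tendsto_one_div_add_atTop_nhds_zero_nat.comp hφ.tendsto_atTop)
    filter_upwards [hφ.tendsto_atTop.eventually_ge_atTop i] with n hn
    exact (hclose (φ n) i hn).le
  have := ge_of_tendsto' (hxa.dist hyb) fun n => (hfar (φ n)).le
  rw [hab, dist_self] at this
  linarith

theorem exists_eq_of_isSeparatedIn (h : IsC2Extension p q c V f) {ε : ℝ} (hε : 0 < ε) :
    ∃ N : ℕ, ∃ δ > (0 : ℝ), ∀ {n : ℕ} {E : Finset (ℂ × ℂ)},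
      IsSeparatedIn f (closurePeriodicPts V f) n ε E → ∀ x ∈ E, ∀ y ∈ E,
      (∀ i ≤ n + N, ‖projectedOrbit f x i - projectedOrbit f y i‖ < δ) → x = y := by
  obtain ⟨N, δ, hδ, hN⟩ := h.exists_dist_le hε
  refine ⟨N, δ, hδ, fun hE x hx y hy hxy => ?_⟩
  by_contra hne
  obtain ⟨j, hj, hfar⟩ := hE.2 x hx y hy hne
  refine absurd (hN _ (h.mapsTo.iterate j (hE.1 hx)) _ (h.mapsTo.iterate j (hE.1 hy))
    fun i hi => ?_) (not_le.2 hfar)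
  rw [projectedOrbit_iterate, projectedOrbit_iterate]
  exact hxy _ (by omega)

theorem geometricPotential_eq (h : IsC2Extension p q c V f)
    (hrep : IsHyperbolicRepeller p q c (juliaSet p q c)) (hp : p ≠ 0) (hq : q ≠ 0) {x : ℂ × ℂ}
    (hx : x ∈ closurePeriodicPts V f) :
    geometricPotential p q c f x = -logExpansion p q (projectedOrbit f x 0) := by
  have horbit := h.bijOn.mapsTo hx 0
  rw [geometricPotential, norm_deriv_localBranch hp hq horbit.2 (hrep.ne_zero horbit.1),
    Real.log_exp]

theorem birkhoffSum_eq (h : IsC2Extension p q c V f)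
    (hrep : IsHyperbolicRepeller p q c (juliaSet p q c)) (hp : p ≠ 0) (hq : q ≠ 0) {x : ℂ × ℂ}
    (hx : x ∈ closurePeriodicPts V f) (s : ℝ) (n : ℕ) :
    birkhoffSum f (fun x => s * geometricPotential p q c f x) n x =
      -s * logExpansionSum p q (projectedOrbit f x) n := by
  rw [birkhoffSum, logExpansionSum, Finset.mul_sum]
  refine Finset.sum_congr rfl fun i _ => ?_
  rw [h.geometricPotential_eq hrep hp hq (h.mapsTo.iterate i hx), projectedOrbit_iterate, zero_add]
  ring

theorem exists_sum_exp_birkhoffSum_le (h : IsC2Extension p q c V f)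
    (hrep : IsHyperbolicRepeller p q c (juliaSet p q c)) (hq : q ≠ 0) (hpq : q ≤ p) (s : ℝ) {ε : ℝ}
    (hε : 0 < ε) : ∃ N : ℕ, ∃ k : ℝ, ∃ T : Finset ℂ, ↑T ⊆ juliaSet p q c ∧
      ∀ {n : ℕ} {E : Finset (ℂ × ℂ)}, IsSeparatedIn f (closurePeriodicPts V f) n ε E →
        ∑ x ∈ E, Real.exp (birkhoffSum f (fun x => s * geometricPotential p q c f x) n x) ≤
          Real.exp k * ∑ w ∈ T, transferSum p q c s (n + N) w := by
  have hp : p ≠ 0 := by omega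
  obtain ⟨N, δ, hδ, hsep⟩ := h.exists_eq_of_isSeparatedIn hε
  obtain ⟨T, hTΛ, k, -, hpull⟩ := hrep.exists_finset_pullback hq hpq (by positivity : 0 < δ / 4)
  obtain ⟨M, -, hM⟩ := hrep.exists_abs_logExpansion_le
  refine ⟨N, |s| * (N * M) + |s| * k, T, hTΛ, fun {n E} hE => ?_⟩
  have horbit : ∀ x ∈ E, projectedOrbit f x ∈ orbitSpace p q c (juliaSet p q c) := fun x hx =>
    h.bijOn.mapsTo (hE.1 hx)
  choose! Y hY hYT hclose hYx _ using fun x hx =>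
    hpull (isFiniteOrbit_of_mem_orbitSpace (horbit x hx) (n + N)) (horbit x hx (n + N)).1
  calc ∑ x ∈ E, Real.exp (birkhoffSum f (fun x => s * geometricPotential p q c f x) n x)
    _ ≤ ∑ x ∈ E, Real.exp (|s| * (N * M)) *
          Real.exp (-s * logExpansionSum p q (projectedOrbit f x) (n + N)) := by
        refine Finset.sum_le_sum fun x hx => ?_
        rw [h.birkhoffSum_eq hrep hp hq (hE.1 hx), ← Real.exp_add, Real.exp_le_exp]
        refine neg_mul_le_abs_mul_add ?_ s
        rw [abs_sub_comm, logExpansionSum_add, add_sub_cancel_left]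
        exact abs_logExpansionSum_le fun i _ => hM _ (horbit x hx (n + i)).1
    _ ≤ Real.exp (|s| * (N * M)) *
          (Real.exp (|s| * k) * ∑ w ∈ T, transferSum p q c s (n + N) w) := by
        rw [← Finset.mul_sum]
        gcongr
        refine sum_exp_le_mul_sum_transferSum hp s hY hYT hYx fun x hx y hy hxy => ?_
        refine hsep hE x hx y hy fun i hi => ?_
        have hx_close := hclose x hx i hi
        have hy_close := hclose y hy i hi
        rw [norm_sub_rev, hxy i hi] at hx_close
        linarith [norm_sub_le_norm_sub_add_norm_sub (projectedOrbit f x i) (Y y i)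
          (projectedOrbit f y i)]
    _ = Real.exp (|s| * (N * M) + |s| * k) * ∑ w ∈ T, transferSum p q c s (n + N) w := by
        rw [Real.exp_add, mul_assoc]

theorem exists_partitionSup_le (h : IsC2Extension p q c V f)
    (hrep : IsHyperbolicRepeller p q c (juliaSet p q c)) (hq : q ≠ 0) (hpq : q ≤ p) {s P k₀ : ℝ}
    (hP : ∀ n : ℕ, ∀ w ∈ juliaSet p q c, transferSum p q c s n w ≤ Real.exp (n * P + k₀))
    {ε : ℝ} (hε : 0 < ε) : ∃ C, ∀ n : ℕ, partitionSup f (closurePeriodicPts V f)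
      (fun x => s * geometricPotential p q c f x) n ε ≤
        ENNReal.ofReal (Real.exp (n * P + C)) := by
  obtain ⟨N, k, T, hTΛ, hsum⟩ := h.exists_sum_exp_birkhoffSum_le hrep hq hpq s hε
  refine ⟨k + T.card + (N * P + k₀), fun n => iSup₂_le fun E hE => ?_⟩
  rw [← ENNReal.ofReal_sum_of_nonneg fun _ _ => (Real.exp_pos _).le]
  refine ENNReal.ofReal_le_ofReal ((hsum hE).trans ?_)
  calc Real.exp k * ∑ w ∈ T, transferSum p q c s (n + N) w
    _ ≤ Real.exp k * ∑ _ ∈ T, Real.exp ((n + N : ℕ) * P + k₀) := by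
        gcongr with w hw
        exact hP _ w (hTΛ hw)
    _ ≤ Real.exp k * (Real.exp T.card * Real.exp ((n + N : ℕ) * P + k₀)) := by
        rw [Finset.sum_const, nsmul_eq_mul]
        gcongr
        linarith [Real.add_one_le_exp (T.card : ℝ)]
    _ = Real.exp (n * P + (k + T.card + (N * P + k₀))) := by
        rw [← Real.exp_add, ← Real.exp_add]
        push_cast
        congr 1
        ring

theorem exists_le_partitionSup (h : IsC2Extension p q c V f)
    (hrep : IsHyperbolicRepeller p q c (juliaSet p q c)) (hp : p ≠ 0) (hq : q ≠ 0) :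
    ∃ ε > 0, ∀ (s : ℝ) (n : ℕ), ∀ w ∈ juliaSet p q c,
      ENNReal.ofReal (transferSum p q c s n w) ≤ partitionSup f (closurePeriodicPts V f)
        (fun x => s * geometricPotential p q c f x) n ε := by
  classical
  obtain ⟨δ, hδ, huniq⟩ := hrep.exists_eq_of_norm_sub_lt hp hq
  refine ⟨δ / 2, half_pos hδ, fun s n w hw => ?_⟩
  have horbit : ∀ y ∈ backwardOrbits p q c n w, IsFiniteOrbit p q c n y ∧ y n = w := fun y hy =>
    ⟨((mem_backwardOrbits hp).1 hy).1, ((mem_backwardOrbits hp).1 hy).2 n le_rfl⟩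
  choose! u hu huy using fun y hy =>
    hrep.exists_mem_orbitSpace_extending (horbit y hy).1 ((horbit y hy).2.symm ▸ hw)
  choose! x hx hxu using fun y hy => h.bijOn.surjOn (hu y hy)
  have hxy : ∀ y ∈ backwardOrbits p q c n w, ∀ i ≤ n, projectedOrbit f (x y) i = y i :=
    fun y hy i hi => by rw [hxu y hy, huy y hy i hi]
  have hinj : Set.InjOn x (backwardOrbits p q c n w) := fun y hy y' hy' hxx =>
    eq_of_mem_backwardOrbits hp hy hy' fun i hi => by
      rw [← hxy y hy i hi, ← hxy y' hy' i hi, hxx]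
  have hsep : IsSeparatedIn f (closurePeriodicPts V f) n (δ / 2)
      ((backwardOrbits p q c n w).image x) := by
    refine ⟨by simpa [Set.subset_def] using hx, ?_⟩
    simp only [Finset.forall_mem_image]
    intro y hy y' hy' hne
    by_contra! hcon
    refine hne (congrArg x (eq_of_mem_backwardOrbits hp hy hy' (huniq (horbit y hy).1
      (horbit y' hy').1 ((horbit y' hy').2.symm ▸ hw) ((horbit y hy).2.trans (horbit y' hy').2.symm)
      fun i hi => ?_)))
    have hle : dist (f^[i] (x y)).1 (f^[i] (x y')).1 ≤ δ / 2 := (le_max_left _ _).trans (hcon i hi)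
    rw [← hxy y hy i hi.le, ← hxy y' hy' i hi.le, ← dist_eq_norm]
    exact hle.trans_lt (half_lt_self hδ)
  refine le_of_eq_of_le ?_ (le_iSup₂ (α := ENNReal) _ hsep)
  rw [Finset.sum_image hinj, transferSum_eq_sum,
    ENNReal.ofReal_sum_of_nonneg fun _ _ => (Real.exp_pos _).le]
  refine Finset.sum_congr rfl fun y hy => ?_
  rw [h.birkhoffSum_eq hrep hp hq (hx y hy), logExpansionSum_congr fun i hi => hxy y hy i hi.le]

theorem pressure_eq (h : IsC2Extension p q c V f)
    (hrep : IsHyperbolicRepeller p q c (juliaSet p q c)) (hne : (juliaSet p q c).Nonempty)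
    (hq : q ≠ 0) (hpq : q ≤ p) {s P : ℝ} (hP : IsGrowthRate p q c (juliaSet p q c) s P) :
    pressure f (closurePeriodicPts V f) (fun x => s * geometricPotential p q c f x) =
      (P : EReal) := by
  obtain ⟨k, hP⟩ := hP
  refine pressure_eq_of_exponential_growth
    (fun ε hε => h.exists_partitionSup_le hrep hq hpq (fun n w hw => (hP n w hw).2) hε) ?_
  obtain ⟨ε, hε, hle⟩ := h.exists_le_partitionSup hrep (by omega) hq
  obtain ⟨w, hw⟩ := hne
  exact ⟨ε, hε, -k, fun n => (ENNReal.ofReal_le_ofReal (hP n w hw).1).trans (hle s n w hw)⟩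

end IsC2Extension

end Pressure

section Isolation

variable {p q : ℕ} {c : ℂ} {Λ : Set ℂ}

theorem exists_pullback_norm_sub_le_pow_mul (hq : q ≠ 0) (hpq : q ≤ p) {a : ℝ} (ha : 0 < a) :
    ∃ G ≥ (1 : ℝ), ∀ {c : ℂ} {n : ℕ} {z : ℕ → ℂ}, IsFiniteOrbit p q c n z →
      (∀ i ≤ n, a ≤ ‖z i‖ ∧ a ≤ ‖z i - c‖) → ∀ {w : ℂ}, G ^ n * ‖w - z n‖ ≤ a / 2 →
      ∃ y, IsFiniteOrbit p q c n y ∧ y n = w ∧ ∀ i ≤ n, ‖y i - z i‖ ≤ G ^ n * ‖w - z n‖ := by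
  have hexponent : 0 ≤ (p : ℝ) / q - 1 := by
    rw [sub_nonneg, one_le_div (by positivity)]
    exact_mod_cast hpq
  set L := Real.log ((p : ℝ) / q) + ((p : ℝ) / q - 1) * Real.log a with hL
  have hlog : ∀ z : ℂ, a ≤ ‖z‖ → L ≤ logExpansion p q z := fun z hz => by
    rw [hL, logExpansion]
    gcongr
  set G := max 1 (Real.exp (1 - L))
  have hG1 : 1 ≤ G := le_max_left _ _
  refine ⟨G, hG1, fun {c n z} hz hlow w hw => ?_⟩
  induction n generalizing z with
  | zero =>
    refine ⟨fun _ => w, fun i hi => absurd hi i.not_lt_zero, rfl, fun i hi => ?_⟩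
    simp [Nat.le_zero.1 hi]
  | succ n ih =>
    have hstep : G ^ n * ‖w - z (n + 1)‖ ≤ G ^ (n + 1) * ‖w - z (n + 1)‖ := by
      gcongr
      exact n.le_succ
    obtain ⟨x, hx, hxn, hxz⟩ := ih hz.tail (fun i hi => hlow (i + 1) (by omega)) (hstep.trans hw)
    obtain ⟨x₀, hx₀, hx₀z⟩ := (hz 0 n.succ_pos).exists_isImage_norm_sub_le_exp hq hpq
      (norm_pos_iff.1 (ha.trans_le (hlow 0 (Nat.zero_le _)).1)) ha (hlow 1 (by omega)).2 le_rfl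
      (w := x 0) (by rw [mul_one]; exact (hxz 0 n.zero_le).trans (hstep.trans hw))
    refine ⟨cons x₀ x, hx.cons hx₀, hxn, fun i hi => ?_⟩
    match i with
    | 0 =>
      calc ‖x₀ - z 0‖ ≤ Real.exp (1 - logExpansion p q (z 0)) * ‖x 0 - z 1‖ := hx₀z
        _ ≤ G * (G ^ n * ‖w - z (n + 1)‖) := by
            gcongr
            · refine le_trans (Real.exp_le_exp.2 ?_) (le_max_right _ _)
              linarith [hlog _ (hlow 0 (Nat.zero_le _)).1]
            · exact hxz 0 n.zero_le
        _ = G ^ (n + 1) * ‖w - z (n + 1)‖ := by ring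
    | i + 1 => exact (hxz i (by omega)).trans hstep

theorem HasContractingPullbacks.mul_pow_mul_le {r K θ : ℝ}
    (h : HasContractingPullbacks p q c Λ r K θ) {b : ℝ} (hb : 0 ≤ b) (n : ℕ) :
    K * θ ^ n * b ≤ K * b := by
  have hK := h.K_pos
  rw [mul_right_comm]
  exact mul_le_of_le_one_right (by positivity) (pow_le_one₀ h.θ_pos.le h.θ_lt_one.le)

theorem HasContractingPullbacks.exists_mul_pow_le {r K θ : ℝ}
    (h : HasContractingPullbacks p q c Λ r K θ) : ∃ N : ℕ, ∀ n ≥ N, K * θ ^ n ≤ 1 / 2 := by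
  have hK := h.K_pos
  obtain ⟨N, hN⟩ := exists_pow_lt_of_lt_one (by positivity : 0 < 1 / 2 / K) h.θ_lt_one
  rw [lt_div_iff₀' hK] at hN
  refine ⟨N, fun n hn => le_trans ?_ hN.le⟩
  gcongr ?_ * ?_
  exact pow_le_pow_of_le_one h.θ_pos.le h.θ_lt_one.le hn

namespace IsHyperbolicRepeller

theorem exists_norm_sub_le_of_norm_sub_le (h : IsHyperbolicRepeller p q c Λ) (hp : p ≠ 0)
    (hq : q ≠ 0) {r K θ : ℝ} (hpull : HasContractingPullbacks p q c Λ r K θ) :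
    ∃ δ > (0 : ℝ), ∀ {n : ℕ} {x y : ℕ → ℂ}, IsFiniteOrbit p q c n x → IsFiniteOrbit p q c n y →
      y n ∈ Λ → (∀ i ≤ n, ‖x i - y i‖ ≤ δ) →
      ∀ i ≤ n, ‖x i - y i‖ ≤ K * θ ^ (n - i) * ‖x n - y n‖ := by
  have hr := hpull.r_pos
  have hK := hpull.K_pos
  obtain ⟨κ, hκ, huniq⟩ := Corr.exists_eq_of_norm_sub_lt hp
  obtain ⟨a, ha, hlow⟩ := h.exists_le_norm hp hq
  refine ⟨min r (min (a / 2) (κ * (a / 2) / (2 * (K + 1)))), by positivity,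
    fun {n x y} hx hy hn hxy i hi => ?_⟩
  simp only [le_min_iff] at hxy
  obtain ⟨x', hx', hxn', hxy', -⟩ := hpull.exists_pullback hy hn (hxy n le_rfl).1
  have heq : ∀ j ≤ n, x' j = x j := by
    refine huniq hx' hx hxn' fun j hj => ?_
    obtain ⟨-, hxy_a, hxy_κ⟩ := hxy j hj.le
    have hxj : a / 2 ≤ ‖x j‖ := by
      have := norm_sub_norm_le (y j) (x j)
      rw [norm_sub_rev] at this
      linarith [(hlow _ (h.mem_of_isFiniteOrbit hy hn hj.le)).1]
    calc ‖x' j - x j‖ ≤ ‖x' j - y j‖ + ‖x j - y j‖ := by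
          rw [norm_sub_rev (x j)]
          exact norm_sub_le_norm_sub_add_norm_sub _ _ _
      _ ≤ K * (κ * (a / 2) / (2 * (K + 1))) + κ * (a / 2) / (2 * (K + 1)) := by
          gcongr
          refine ((hxy' j hj.le).trans (hpull.mul_pow_mul_le (norm_nonneg _) _)).trans ?_
          gcongr
          exact (hxy n le_rfl).2.2
      _ = κ * (a / 2) / 2 := by field_simp
      _ < κ * (a / 2) := half_lt_self (by positivity)
      _ ≤ κ * ‖x j‖ := by gcongr
  rw [← heq i hi]
  exact hxy' i hi

theorem exists_norm_sub_le_half (h : IsHyperbolicRepeller p q c Λ) (hq : q ≠ 0) (hpq : q ≤ p) :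
    ∃ η > (0 : ℝ), ∃ N : ℕ, ∀ {z : ℕ → ℂ}, IsFiniteOrbit p q c N z →
      (∀ i ≤ N, z i ∈ Metric.thickening η Λ) → ∀ w ∈ Λ, ‖w - z N‖ ≤ η →
      ∃ y ∈ Λ, ‖y - z 0‖ ≤ 1 / 2 * ‖w - z N‖ := by
  have hp : p ≠ 0 := by omega
  obtain ⟨r, K, θ, hpull⟩ := h.exists_hasContractingPullbacks hq hpq
  obtain ⟨a, ha, hlow⟩ := h.exists_le_norm hp hq
  obtain ⟨δ, hδ, hclose⟩ := h.exists_norm_sub_le_of_norm_sub_le hp hq hpull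
  obtain ⟨G, hG, hcrude⟩ := exists_pullback_norm_sub_le_pow_mul hq hpq (half_pos ha)
  obtain ⟨N, hN⟩ := hpull.exists_mul_pow_le
  have hG0 : 0 < G := one_pos.trans_le hG
  refine ⟨min (a / 2) (min (a / 2 / 2 / G ^ N) (δ / G ^ N)), by positivity, N,
    fun {z} hz hzη w hw hwz => ?_⟩
  have hzlow : ∀ i ≤ N, a / 2 ≤ ‖z i‖ ∧ a / 2 ≤ ‖z i - c‖ := by
    intro i hi
    obtain ⟨y, hy, hyz⟩ := Metric.mem_thickening_iff.1 (hzη i hi)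
    rw [dist_comm, dist_eq_norm] at hyz
    have hdist := hyz.le.trans (min_le_left _ _)
    have hnorm := norm_sub_norm_le y (z i)
    have hnorm_sub := norm_sub_norm_le (y - c) (z i - c)
    rw [sub_sub_sub_cancel_right] at hnorm_sub
    constructor <;> linarith [hlow y hy]
  simp only [le_min_iff, le_div_iff₀' (pow_pos hG0 N)] at hwz
  obtain ⟨y, hy, hyN, hyz⟩ := hcrude hz hzlow hwz.2.1
  refine ⟨y 0, h.mem_of_isFiniteOrbit hy (hyN ▸ hw) N.zero_le, ?_⟩
  have hzy := hclose hz hy (hyN ▸ hw)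
    (fun i hi => by rw [norm_sub_rev]; exact (hyz i hi).trans hwz.2.2) 0 N.zero_le
  rw [norm_sub_rev, norm_sub_rev (z N), hyN] at hzy
  exact hzy.trans (by gcongr; exact hN _ le_rfl)

theorem exists_isolating (h : IsHyperbolicRepeller p q c Λ) (hq : q ≠ 0) (hpq : q ≤ p) :
    ∃ η > (0 : ℝ), ∀ z ∈ orbitSpace p q c (Metric.thickening η Λ), ∀ i, z i ∈ Λ := by
  obtain ⟨η, hη, N, hhalf⟩ := h.exists_norm_sub_le_half hq hpq
  refine ⟨η, hη, fun z hz => ?_⟩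
  obtain ⟨y₀, hy₀, -⟩ := Metric.mem_thickening_iff.1 (hz 0).1
  have hne : Λ.Nonempty := ⟨y₀, hy₀⟩
  have hlt : ∀ i, Metric.infDist (z i) Λ < η := fun i =>
    (Metric.mem_thickening_iff_infDist_lt hne).1 (hz i).1
  have hcontract : ∀ i, Metric.infDist (z i) Λ ≤ 1 / 2 * Metric.infDist (z (i + N)) Λ := by
    intro i
    obtain ⟨w, hw, hwz⟩ := h.isCompact.exists_infDist_eq_dist hne (z (i + N))
    rw [dist_comm, dist_eq_norm] at hwz
    obtain ⟨y, hy, hyz⟩ := hhalf (z := fun j => z (i + j)) (fun j _ => (hz (i + j)).2)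
      (fun j _ => (hz (i + j)).1) w hw (hwz ▸ (hlt (i + N)).le)
    rw [hwz]
    refine (Metric.infDist_le_dist_of_mem hy).trans ?_
    rwa [dist_comm, dist_eq_norm]
  have hpow : ∀ n i, Metric.infDist (z i) Λ ≤ (1 / 2) ^ n * η := by
    intro n
    induction n with
    | zero => simpa using fun i => (hlt i).le
    | succ n ih => exact fun i => by rw [pow_succ']; linarith [hcontract i, ih (i + N)]
  intro i
  rw [h.isCompact.isClosed.mem_iff_infDist_zero hne]
  have hlim : Tendsto (fun n : ℕ => (1 / 2 : ℝ) ^ n * η) atTop (𝓝 0) := by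
    simpa using (tendsto_pow_atTop_nhds_zero_of_lt_one (by norm_num)
      (by norm_num : (1 / 2 : ℝ) < 1)).mul_const η
  exact le_antisymm (ge_of_tendsto' hlim fun n => hpow n i) Metric.infDist_nonneg

theorem exists_contracting_pullback (h : IsHyperbolicRepeller p q c Λ) (hq : q ≠ 0) (hpq : q ≤ p)
    {ε : ℝ} (hε : 0 < ε) : ∃ ρ > (0 : ℝ), ∃ N : ℕ, ∀ {n : ℕ} {x : ℕ → ℂ}, N ≤ n →
      IsFiniteOrbit p q c n x → x n ∈ Λ → ∃ X : ℂ → ℕ → ℂ,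
        (∀ w ∈ Metric.closedBall (x n) ρ, IsFiniteOrbit p q c n (X w) ∧ X w n = w ∧
          (∀ i ≤ n, ‖X w i - x i‖ ≤ ε) ∧ ‖X w 0 - x 0‖ ≤ 1 / 2 * ‖w - x n‖) ∧
        ∀ w ∈ Metric.closedBall (x n) ρ, ∀ w' ∈ Metric.closedBall (x n) ρ ∩ Λ,
          ‖X w 0 - X w' 0‖ ≤ 1 / 2 * ‖w - w'‖ := by
  obtain ⟨r, K, θ, hpull⟩ := h.exists_hasContractingPullbacks hq hpq
  have hr := hpull.r_pos
  have hK := hpull.K_pos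
  obtain ⟨δ, hδ, hclose⟩ := h.exists_norm_sub_le_of_norm_sub_le (by omega) hq hpull
  obtain ⟨N, hN⟩ := hpull.exists_mul_pow_le
  set ρ := min r (min ε (δ / 2) / K)
  have hρK : K * ρ ≤ min ε (δ / 2) := by
    rw [← le_div_iff₀' hK]
    exact min_le_right _ _
  refine ⟨ρ, by positivity, N, fun {n x} hn hx hxn => ?_⟩
  have hball : ∀ w ∈ Metric.closedBall (x n) ρ, ‖w - x n‖ ≤ ρ := fun w => mem_closedBall_iff_norm.1
  choose! X hX hXn hXx _ using fun w hw =>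
    hpull.exists_pullback hx hxn (w := w) ((hball w hw).trans (min_le_left _ _))
  have hXmin : ∀ w ∈ Metric.closedBall (x n) ρ, ∀ i ≤ n, ‖X w i - x i‖ ≤ min ε (δ / 2) :=
    fun w hw i hi => ((hXx w hw i hi).trans (hpull.mul_pow_mul_le (norm_nonneg _) _)).trans
      (le_trans (by gcongr; exact hball w hw) hρK)
  refine ⟨X, fun w hw => ⟨hX w hw, hXn w hw, fun i hi => (hXmin w hw i hi).trans (min_le_left _ _),
    (hXx w hw 0 n.zero_le).trans (by gcongr; exact hN n hn)⟩, fun w hw w' ⟨hw', hw'Λ⟩ => ?_⟩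
  have hXX : ∀ i ≤ n, ‖X w i - X w' i‖ ≤ δ := fun i hi => by
    have hwx := (hXmin w hw i hi).trans (min_le_right _ _)
    have hwx' := (hXmin w' hw' i hi).trans (min_le_right _ _)
    rw [norm_sub_rev] at hwx'
    linarith [norm_sub_le_norm_sub_add_norm_sub (X w i) (x i) (X w' i)]
  have hXX0 := hclose (hX w hw) (hX w' hw') (by rwa [hXn w' hw']) hXX 0 n.zero_le
  rw [hXn w hw, hXn w' hw'] at hXX0
  exact hXX0.trans (by gcongr; exact hN n hn)

/-- The Anosov closing lemma: the pull-back along an almost closed orbit is a contraction, and its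
fixed point closes up. -/
theorem exists_closing (h : IsHyperbolicRepeller p q c Λ) (hq : q ≠ 0) (hpq : q ≤ p) {ε : ℝ}
    (hε : 0 < ε) : ∃ ρ > (0 : ℝ), ∃ N : ℕ, ∀ {n : ℕ} {x : ℕ → ℂ}, N ≤ n → IsFiniteOrbit p q c n x →
      x n ∈ Λ → ‖x 0 - x n‖ ≤ ρ → ∃ y, IsFiniteOrbit p q c n y ∧ y n ∈ Λ ∧ y n = y 0 ∧
        ∀ i ≤ n, ‖y i - x i‖ ≤ ε := by
  obtain ⟨ρ, hρ, N, hpull⟩ := h.exists_contracting_pullback hq hpq hε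
  refine ⟨ρ / 2, half_pos hρ, N, fun {n x} hn hx hxn hx0 => ?_⟩
  obtain ⟨X, hX, hXX⟩ := hpull hn hx hxn
  set D : Set ℂ := Metric.closedBall (x n) ρ ∩ Λ
  have hXΛ : ∀ w ∈ D, X w n ∈ Λ := fun w hw => by rw [(hX w hw.1).2.1]; exact hw.2
  have hmaps : Set.MapsTo (fun w => X w 0) D D := by
    refine fun w hw => ⟨mem_closedBall_iff_norm.2 ?_,
      h.mem_of_isFiniteOrbit (hX w hw.1).1 (hXΛ w hw) n.zero_le⟩
    linarith [norm_sub_le_norm_sub_add_norm_sub (X w 0) (x 0) (x n), (hX w hw.1).2.2.2,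
      mem_closedBall_iff_norm.1 hw.1]
  have hcontract : ContractingWith (1 / 2) (hmaps.restrict (fun w => X w 0) D D) :=
    ⟨by norm_num, LipschitzWith.of_dist_le_mul fun w w' => by
      simpa [Subtype.dist_eq, dist_eq_norm] using hXX w w.2.1 w' w'.2⟩
  obtain ⟨w, hw, hfix, -⟩ := hcontract.exists_fixedPoint'
    (Metric.isClosed_closedBall.inter h.isCompact.isClosed).isComplete hmaps
    (⟨Metric.mem_closedBall_self hρ.le, hxn⟩ : x n ∈ D) (edist_ne_top _ _)
  obtain ⟨hXw, hXwn, hXwx, -⟩ := hX w hw.1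
  exact ⟨X w, hXw, hXΛ w hw, hXwn.trans hfix.symm, hXwx⟩

theorem mod_mem_orbitSpace (h : IsHyperbolicRepeller p q c Λ) {n : ℕ} {y : ℕ → ℂ} (hn : 0 < n)
    (hy : IsFiniteOrbit p q c n y) (hyn : y n ∈ Λ) (hy0 : y n = y 0) :
    (fun i => y (i % n)) ∈ orbitSpace p q c Λ := by
  intro i
  have hlt := Nat.mod_lt i hn
  refine ⟨h.mem_of_isFiniteOrbit hy hyn hlt.le, ?_⟩
  have hnext : y ((i + 1) % n) = y (i % n + 1) := by
    rw [← Nat.mod_add_mod]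
    rcases (Nat.succ_le_of_lt hlt).lt_or_eq with hlt | heq
    · rw [Nat.mod_eq_of_lt hlt]
    · rw [show i % n + 1 = n from heq, Nat.mod_self, hy0]
  simp only [hnext]
  exact hy _ hlt

theorem exists_periodic_norm_sub_lt (h : IsHyperbolicRepeller p q c Λ) (hLEO : IsLEO p q c Λ)
    (hq : q ≠ 0) (hpq : q ≤ p) {z : ℕ → ℂ} (hz : z ∈ orbitSpace p q c Λ) (N : ℕ) {ε : ℝ}
    (hε : 0 < ε) : ∃ y ∈ orbitSpace p q c Λ, (∃ m > 0, ∀ i, y (i + m) = y i) ∧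
      ∀ i ≤ N, ‖y i - z i‖ < ε := by
  obtain ⟨ρ, hρ, N₀, hclosing⟩ := h.exists_closing hq hpq (by positivity : 0 < ε / 3)
  obtain ⟨r, hr, _, -, hpull⟩ := h.exists_pullback_abs_logExpansionSum_sub_le hq hpq
    (by positivity : 0 < min ρ (ε / 3))
  obtain ⟨_, hreturn⟩ := hLEO.exists_uniform h.isCompact hr
  set n := N + N₀ + 1
  obtain ⟨m, -, u, hu, hu0, huz, hum⟩ := hreturn (z n) (hz n).1 (z 0) (hz 0).1
  obtain ⟨v, hv, hvn, hvz, -⟩ := hpull (isFiniteOrbit_of_mem_orbitSpace hz n) (hz n).1 hu0 huz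
  obtain ⟨y, hy, hyΛ, hy0, hyv⟩ := hclosing (n := n + m) (x := glue n v u) (by omega)
    (hv.glue hu hvn) (by rw [glue_add hvn, hum]; exact (hz 0).1) (by
      rw [glue_add hvn, hum, glue_of_le n.zero_le]
      exact (hvz 0 n.zero_le).trans (min_le_left _ _))
  refine ⟨_, h.mod_mem_orbitSpace (by omega) hy hyΛ hy0, ⟨n + m, by omega, by simp⟩, fun i hi => ?_⟩
  have hyi := hyv i (by omega)
  rw [glue_of_le (by omega)] at hyi
  rw [Nat.mod_eq_of_lt (by omega)]
  linarith [norm_sub_le_norm_sub_add_norm_sub (y i) (v i) (z i),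
    (hvz i (by omega)).trans (min_le_right _ _)]

end IsHyperbolicRepeller

end Isolation

section BoundedPowerSeries

variable {𝕜 : Type*} [NormedField 𝕜] {ε : 𝕜} {R : ℝ} {a : ℕ → 𝕜}

theorem norm_pow_mul_le_of_norm_le (ha : ∀ i, ‖a i‖ ≤ R) (i : ℕ) : ‖ε ^ i * a i‖ ≤ ‖ε‖ ^ i * R := by
  rw [norm_mul, norm_pow]
  gcongr
  exact ha i

theorem summable_norm_pow_mul (hε : ‖ε‖ < 1) : Summable fun i => ‖ε‖ ^ i * R :=
  (summable_geometric_of_lt_one (norm_nonneg ε) hε).mul_right R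

theorem norm_tsum_pow_mul_le (hε : ‖ε‖ < 1) (ha : ∀ i, ‖a i‖ ≤ R) :
    ‖∑' i, ε ^ i * a i‖ ≤ (1 - ‖ε‖)⁻¹ * R := by
  rw [← tsum_geometric_of_lt_one (norm_nonneg ε) hε, ← tsum_mul_right]
  exact tsum_of_norm_bounded (summable_norm_pow_mul hε).hasSum (norm_pow_mul_le_of_norm_le ha)

variable [CompleteSpace 𝕜]

theorem summable_pow_mul_of_norm_le (hε : ‖ε‖ < 1) (ha : ∀ i, ‖a i‖ ≤ R) :
    Summable fun i => ε ^ i * a i :=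
  .of_norm_bounded (summable_norm_pow_mul hε) (norm_pow_mul_le_of_norm_le ha)

theorem tsum_pow_mul_eq_add (hε : ‖ε‖ < 1) (ha : ∀ i, ‖a i‖ ≤ R) :
    ∑' i, ε ^ i * a i = a 0 + ε * ∑' i, ε ^ i * a (i + 1) := by
  rw [(summable_pow_mul_of_norm_le hε ha).tsum_eq_zero_add, ← tsum_mul_left]
  simp only [pow_zero, one_mul, pow_succ', mul_assoc]

theorem tsum_pow_mul_eq_of_eq_add_mul (hε : ‖ε‖ < 1) {w : ℕ → 𝕜} {B : ℝ} (hw : ∀ n, ‖w n‖ ≤ B)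
    (ha : ∀ i, ‖a i‖ ≤ R) (hrec : ∀ n, w n = a n + ε * w (n + 1)) :
    ∑' i, ε ^ i * a i = w 0 := by
  have hpartial : ∀ n, ∑ i ∈ Finset.range n, ε ^ i * a i = w 0 - ε ^ n * w n := by
    intro n
    induction n with
    | zero => simp
    | succ n ih => rw [Finset.sum_range_succ, ih, hrec n]; ring
  refine HasSum.tsum_eq ((summable_pow_mul_of_norm_le hε ha).hasSum_iff_tendsto_nat.2 ?_)
  have hrem : Tendsto (fun n => ε ^ n * w n) atTop (𝓝 0) :=
    squeeze_zero_norm (norm_pow_mul_le_of_norm_le hw) (by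
      simpa using (tendsto_pow_atTop_nhds_zero_of_lt_one (norm_nonneg ε) hε).mul_const B)
  simpa only [hpartial, sub_zero] using hrem.const_sub (w 0)

end BoundedPowerSeries

section CodedShift

/-- The point of `ℂ²` that codes the sequence `z`: its second coordinate is a power series in a
small parameter `ε` whose coefficients are the points following `z 0`. -/
def orbitCode (ε : ℂ) (z : ℕ → ℂ) : ℂ × ℂ := (z 0, ∑' i, ε ^ i * z (i + 1))

/-- The domain of the coded shift: the points `x` for which some image of `x.1` is `r`-close to
`x.2`. -/
def codedShiftDomain (p q : ℕ) (c : ℂ) (U : Set ℂ) (r : ℝ) : Set (ℂ × ℂ) :=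
  {x | x.1 ∈ U ∧ ∃ v, IsImage p q c x.1 v ∧ ‖x.2 - v‖ < r}

/-- An image of `x.1` that is `r`-close to `x.2`, arbitrary if there is none. -/
def nearbyImage (p q : ℕ) (c : ℂ) (r : ℝ) (x : ℂ × ℂ) : ℂ :=
  Classical.epsilon fun v => IsImage p q c x.1 v ∧ ‖x.2 - v‖ < r

/-- The map of `ℂ²` that is the shift on codes of orbits: the leading coefficient of the power
series in the second coordinate is recovered as the image close to it. -/
def codedShift (p q : ℕ) (c : ℂ) (r : ℝ) (ε : ℂ) (x : ℂ × ℂ) : ℂ × ℂ :=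
  (nearbyImage p q c r x, (x.2 - nearbyImage p q c r x) / ε)

/-- The conditions under which the coded shift on `codedShiftDomain p q c U r` is holomorphic and
has the codes of the orbits in `Λ`, a subset of the disc of radius `R`, as its maximal invariant
set: `U` is an isolating neighbourhood of `Λ` over which distinct images are `2r`-apart, and `ε` is
so small that the code of an orbit lies in the domain. -/
structure IsCoding (p q : ℕ) (c : ℂ) (Λ U : Set ℂ) (r R : ℝ) (ε : ℂ) : Prop where
  isOpen : IsOpen U
  zero_notMem : (0 : ℂ) ∉ U
  subset : Λ ⊆ U
  mem_of_mem_orbitSpace : ∀ z ∈ orbitSpace p q c U, ∀ i, z i ∈ Λ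
  eq_of_isImage : ∀ z ∈ U, ∀ v v', IsImage p q c z v → IsImage p q c z v' →
    ‖v - v'‖ < 2 * r → v = v'
  norm_le : ∀ z ∈ Λ, ‖z‖ ≤ R
  ε_ne_zero : ε ≠ 0
  norm_ε_lt_one : ‖ε‖ < 1
  norm_ε_mul_lt : ‖ε‖ * (R + r) < r

variable {p q : ℕ} {c : ℂ} {Λ U : Set ℂ} {r R : ℝ} {ε : ℂ}

theorem isImage_nearbyImage {x : ℂ × ℂ} (hx : x ∈ codedShiftDomain p q c U r) :
    IsImage p q c x.1 (nearbyImage p q c r x) :=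
  (Classical.epsilon_spec hx.2).1

theorem norm_sub_nearbyImage_lt {x : ℂ × ℂ} (hx : x ∈ codedShiftDomain p q c U r) :
    ‖x.2 - nearbyImage p q c r x‖ < r :=
  (Classical.epsilon_spec hx.2).2

theorem isCompact_orbitSpace (hΛ : IsCompact Λ) : IsCompact (orbitSpace p q c Λ) := by
  have heq : orbitSpace p q c Λ =
      Set.univ.pi (fun _ => Λ) ∩ ⋂ i, {z : ℕ → ℂ | IsImage p q c (z i) (z (i + 1))} := by
    ext z
    simp [orbitSpace, forall_and]
  rw [heq]
  exact (isCompact_univ_pi fun _ => hΛ).inter_right <| isClosed_iInter fun i =>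
    isClosed_eq (((continuous_apply (i + 1)).sub continuous_const).pow q)
      ((continuous_apply i).pow p)

namespace IsCoding

theorem nearbyImage_eq (h : IsCoding p q c Λ U r R ε) {x : ℂ × ℂ} {v : ℂ} (hx : x.1 ∈ U)
    (hv : IsImage p q c x.1 v) (hvr : ‖x.2 - v‖ < r) : nearbyImage p q c r x = v := by
  have hxV : x ∈ codedShiftDomain p q c U r := ⟨hx, v, hv, hvr⟩
  refine h.eq_of_isImage _ hx _ _ (isImage_nearbyImage hxV) hv ?_
  have hnear := norm_sub_nearbyImage_lt hxV
  rw [norm_sub_rev] at hnear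
  linarith [norm_sub_le_norm_sub_add_norm_sub (nearbyImage p q c r x) x.2 v]

theorem ne_zero (h : IsCoding p q c Λ U r R ε) {x : ℂ × ℂ}
    (hx : x ∈ codedShiftDomain p q c U r) : x.1 ≠ 0 :=
  fun hx0 => h.zero_notMem (hx0 ▸ hx.1)

theorem eventually_nearbyImage_eq (h : IsCoding p q c Λ U r R ε) (hq : q ≠ 0) {x : ℂ × ℂ}
    (hx : x ∈ codedShiftDomain p q c U r) :
    ∀ᶠ y in 𝓝 x, y ∈ codedShiftDomain p q c U r ∧
      nearbyImage p q c r y = localBranch p q c x.1 (nearbyImage p q c r x) y.1 := by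
  set g := localBranch p q c x.1 (nearbyImage p q c r x) with hg
  have hcont : ContinuousAt (fun y : ℂ × ℂ => ‖y.2 - g y.1‖) x :=
    (continuousAt_snd.sub ((hasDerivAt_localBranch p q c _ (h.ne_zero hx)).continuousAt.comp
      continuousAt_fst)).norm
  have hlt : ∀ᶠ y : ℂ × ℂ in 𝓝 x, ‖y.2 - g y.1‖ < r :=
    hcont.eventually_lt continuousAt_const (by
      rw [hg, localBranch_self p q c _ (h.ne_zero hx)]
      exact norm_sub_nearbyImage_lt hx)
  have himage : ∀ᶠ y : ℂ × ℂ in 𝓝 x, IsImage p q c y.1 (g y.1) :=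
    continuousAt_fst.eventually
      (eventually_isImage_localBranch p q c hq (h.ne_zero hx) (isImage_nearbyImage hx))
  filter_upwards [continuousAt_fst.eventually_mem (h.isOpen.mem_nhds hx.1), himage, hlt]
    with y hyU hyg hyr
  exact ⟨⟨hyU, _, hyg, hyr⟩, h.nearbyImage_eq hyU hyg hyr⟩

theorem isOpen_codedShiftDomain (h : IsCoding p q c Λ U r R ε) (hq : q ≠ 0) :
    IsOpen (codedShiftDomain p q c U r) :=
  isOpen_iff_mem_nhds.2 fun _ hx => (h.eventually_nearbyImage_eq hq hx).mono fun _ hy => hy.1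

theorem differentiableOn_codedShift (h : IsCoding p q c Λ U r R ε) (hq : q ≠ 0) :
    DifferentiableOn ℂ (codedShift p q c r ε) (codedShiftDomain p q c U r) := by
  intro x hx
  set g : ℂ × ℂ → ℂ := fun y => localBranch p q c x.1 (nearbyImage p q c r x) y.1
  have hgx : DifferentiableAt ℂ g x :=
    (hasDerivAt_localBranch p q c _ (h.ne_zero hx)).differentiableAt.comp x differentiableAt_fst
  have hpair : DifferentiableAt ℂ (fun y : ℂ × ℂ => (g y, (y.2 - g y) / ε)) x := by
    simp only [div_eq_mul_inv]
    exact hgx.prodMk ((differentiableAt_snd.sub hgx).mul_const _)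
  refine (hpair.congr_of_eventuallyEq ?_).differentiableWithinAt
  filter_upwards [h.eventually_nearbyImage_eq hq hx] with y hy
  rw [codedShift, hy.2]

theorem norm_orbitCode_snd_sub_lt (h : IsCoding p q c Λ U r R ε) {z : ℕ → ℂ}
    (hz : z ∈ orbitSpace p q c Λ) : ‖(orbitCode ε z).2 - z 1‖ < r := by
  have hzR : ∀ i, ‖z i‖ ≤ R := fun i => h.norm_le _ (hz i).1
  have hε : 0 < 1 - ‖ε‖ := sub_pos.2 h.norm_ε_lt_one
  rw [orbitCode, tsum_pow_mul_eq_add h.norm_ε_lt_one fun i => hzR (i + 1), zero_add,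
    add_sub_cancel_left, norm_mul]
  calc ‖ε‖ * ‖∑' i, ε ^ i * z (i + 1 + 1)‖ ≤ ‖ε‖ * ((1 - ‖ε‖)⁻¹ * R) := by
        gcongr
        exact norm_tsum_pow_mul_le h.norm_ε_lt_one fun i => hzR (i + 1 + 1)
    _ = ‖ε‖ * R / (1 - ‖ε‖) := by ring
    _ < r := by
        rw [div_lt_iff₀ hε]
        linarith [h.norm_ε_mul_lt]

theorem orbitCode_mem (h : IsCoding p q c Λ U r R ε) {z : ℕ → ℂ}
    (hz : z ∈ orbitSpace p q c Λ) : orbitCode ε z ∈ codedShiftDomain p q c U r :=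
  ⟨h.subset (hz 0).1, z 1, (hz 0).2, h.norm_orbitCode_snd_sub_lt hz⟩

theorem codedShift_orbitCode (h : IsCoding p q c Λ U r R ε) {z : ℕ → ℂ}
    (hz : z ∈ orbitSpace p q c Λ) :
    codedShift p q c r ε (orbitCode ε z) = orbitCode ε fun i => z (i + 1) := by
  have hnear : nearbyImage p q c r (orbitCode ε z) = z 1 :=
    h.nearbyImage_eq (h.subset (hz 0).1) (hz 0).2 (h.norm_orbitCode_snd_sub_lt hz)
  refine Prod.ext hnear ?_
  have hsnd := tsum_pow_mul_eq_add h.norm_ε_lt_one fun i => h.norm_le _ (hz (i + 1)).1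
  rw [codedShift, hnear]
  simp only [orbitCode]
  rw [hsnd, zero_add, add_sub_cancel_left, mul_div_cancel_left₀ _ h.ε_ne_zero]

theorem iterate_codedShift_orbitCode (h : IsCoding p q c Λ U r R ε) {z : ℕ → ℂ}
    (hz : z ∈ orbitSpace p q c Λ) (n : ℕ) :
    (codedShift p q c r ε)^[n] (orbitCode ε z) = orbitCode ε fun i => z (n + i) := by
  induction n with
  | zero => simp only [Function.iterate_zero_apply, zero_add]
  | succ n ih =>
    rw [Function.iterate_succ_apply', ih, h.codedShift_orbitCode (shift_mem_orbitSpace hz n)]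
    simp only [add_assoc, add_comm 1]

theorem projectedOrbit_orbitCode (h : IsCoding p q c Λ U r R ε) {z : ℕ → ℂ}
    (hz : z ∈ orbitSpace p q c Λ) :
    projectedOrbit (codedShift p q c r ε) (orbitCode ε z) = z := by
  funext n
  rw [projectedOrbit, h.iterate_codedShift_orbitCode hz, orbitCode, add_zero]

theorem exists_orbitCode_eq (h : IsCoding p q c Λ U r R ε) {x : ℂ × ℂ}
    (hx : ∀ i, (codedShift p q c r ε)^[i] x ∈ codedShiftDomain p q c U r) :
    ∃ z ∈ orbitSpace p q c Λ, orbitCode ε z = x := by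
  set f := codedShift p q c r ε with hf
  set z := projectedOrbit f x with hz
  have hsucc : ∀ i, f^[i + 1] x = f (f^[i] x) := fun i => Function.iterate_succ_apply' f i x
  have hnear : ∀ i, nearbyImage p q c r (f^[i] x) = z (i + 1) := fun i => by
    rw [hz, projectedOrbit, hsucc, hf, codedShift]
  have himage : ∀ i, IsImage p q c (z i) (z (i + 1)) := fun i =>
    hnear i ▸ isImage_nearbyImage (hx i)
  have hzΛ : ∀ i, z i ∈ Λ := h.mem_of_mem_orbitSpace z fun i => ⟨(hx i).1, himage i⟩
  refine ⟨z, fun i => ⟨hzΛ i, himage i⟩, Prod.ext rfl ?_⟩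
  refine tsum_pow_mul_eq_of_eq_add_mul h.norm_ε_lt_one (w := fun n => (f^[n] x).2) (B := r + R)
    (fun n => ?_) (fun i => h.norm_le _ (hzΛ (i + 1))) fun n => ?_
  · have hclose := norm_sub_nearbyImage_lt (hx n)
    rw [hnear] at hclose
    linarith [norm_le_norm_sub_add (f^[n] x).2 (z (n + 1)), h.norm_le _ (hzΛ (n + 1))]
  · have hsnd : (f^[n + 1] x).2 = ((f^[n] x).2 - z (n + 1)) / ε := by
      rw [← hnear n, hsucc, hf, codedShift]
    rw [hsnd, mul_div_cancel₀ _ h.ε_ne_zero, add_sub_cancel]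

theorem setOf_forall_iterate_mem (h : IsCoding p q c Λ U r R ε) :
    {x | ∀ i, (codedShift p q c r ε)^[i] x ∈ codedShiftDomain p q c U r} =
      orbitCode ε '' orbitSpace p q c Λ := by
  refine Set.Subset.antisymm (fun x hx => h.exists_orbitCode_eq hx) ?_
  rintro _ ⟨z, hz, rfl⟩ i
  rw [h.iterate_codedShift_orbitCode hz]
  exact h.orbitCode_mem (shift_mem_orbitSpace hz i)

theorem continuousOn_orbitCode (h : IsCoding p q c Λ U r R ε) :
    ContinuousOn (orbitCode ε) (orbitSpace p q c Λ) :=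
  (continuous_apply 0).continuousOn.prodMk <|
    continuousOn_tsum (fun i => (continuous_const.mul (continuous_apply (i + 1))).continuousOn)
      (summable_norm_pow_mul h.norm_ε_lt_one) fun i _ hz =>
        norm_pow_mul_le_of_norm_le (fun i => h.norm_le _ (hz (i + 1)).1) i

theorem closurePeriodicPts_codedShift (h : IsCoding p q c Λ U r R ε)
    (hΛ : IsHyperbolicRepeller p q c Λ) (hLEO : IsLEO p q c Λ) (hq : q ≠ 0) (hpq : q ≤ p) :
    closurePeriodicPts (codedShiftDomain p q c U r) (codedShift p q c r ε) =
      orbitCode ε '' orbitSpace p q c Λ := by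
  have hcompact : IsCompact (orbitCode ε '' orbitSpace p q c Λ) :=
    (isCompact_orbitSpace hΛ.isCompact).image_of_continuousOn h.continuousOn_orbitCode
  refine Set.Subset.antisymm (closure_minimal (fun x hx => ?_) hcompact.isClosed) ?_
  · rw [← h.setOf_forall_iterate_mem]
    exact hx.2
  rintro _ ⟨z, hz, rfl⟩
  choose y hy hperiodic hyz using fun n : ℕ =>
    hΛ.exists_periodic_norm_sub_lt hLEO hq hpq hz n (Nat.one_div_pos_of_nat (n := n) (α := ℝ))
  have hlim : Tendsto y atTop (𝓝 z) := by
    refine tendsto_pi_nhds.2 fun i => tendsto_iff_norm_sub_tendsto_zero.2 ?_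
    refine squeeze_zero' (.of_forall fun _ => norm_nonneg _) ?_
      tendsto_one_div_add_atTop_nhds_zero_nat
    filter_upwards [eventually_ge_atTop i] with n hn
    exact (hyz n i hn).le
  refine mem_closure_of_tendsto ((h.continuousOn_orbitCode z hz).tendsto.comp
    (tendsto_nhdsWithin_iff.2 ⟨hlim, .of_forall hy⟩)) (.of_forall fun n => ⟨?_, ?_⟩)
  · obtain ⟨m, hm, hper⟩ := hperiodic n
    refine ⟨m, hm, ?_⟩
    rw [Function.comp_apply, h.iterate_codedShift_orbitCode (hy n)]
    simp only [add_comm m, hper]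
  · exact h.setOf_forall_iterate_mem.symm.subset ⟨y n, hy n, rfl⟩

theorem image_codedShift (h : IsCoding p q c Λ U r R ε) (hΛ : IsHyperbolicRepeller p q c Λ)
    (hp : p ≠ 0) : codedShift p q c r ε '' (orbitCode ε '' orbitSpace p q c Λ) =
      orbitCode ε '' orbitSpace p q c Λ := by
  ext x
  constructor
  · rintro ⟨_, ⟨z, hz, rfl⟩, rfl⟩
    exact ⟨fun i => z (i + 1), fun i => hz (i + 1), (h.codedShift_orbitCode hz).symm⟩
  · rintro ⟨z, hz, rfl⟩
    obtain ⟨v, hv⟩ := preimageFinset_nonempty (p := p) (q := q) (c := c) (z 0) hp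
    rw [mem_preimageFinset hp] at hv
    have hcons : cons v z ∈ orbitSpace p q c Λ := fun i => match i with
      | 0 => ⟨hΛ.mem_of_isImage hv (hz 0).1, hv⟩
      | i + 1 => hz i
    exact ⟨_, ⟨cons v z, hcons, rfl⟩, h.codedShift_orbitCode hcons⟩

theorem isC2Extension (h : IsCoding p q c (juliaSet p q c) U r R ε)
    (hrep : IsHyperbolicRepeller p q c (juliaSet p q c)) (hLEO : IsLEO p q c (juliaSet p q c))
    (hq : q ≠ 0) (hpq : q ≤ p) :
    IsC2Extension p q c (codedShiftDomain p q c U r) (codedShift p q c r ε) := by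
  have hJ := h.closurePeriodicPts_codedShift hrep hLEO hq hpq
  have hinv := h.setOf_forall_iterate_mem
  refine ⟨h.isOpen_codedShiftDomain hq, h.differentiableOn_codedShift hq, ?_, ?_, ?_, ?_, ?_⟩ <;>
    rw [hJ]
  · exact (isCompact_orbitSpace hrep.isCompact).image_of_continuousOn h.continuousOn_orbitCode
  · rw [← hinv]
    exact fun x hx => hx 0
  · exact h.image_codedShift hrep (by omega)
  · rw [← hinv]
    ext x
    exact ⟨fun ⟨hxV, hx⟩ i => i.casesOn hxV hx, fun hx => ⟨hx 0, fun i => hx (i + 1)⟩⟩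
  · have hleft : Set.LeftInvOn (projectedOrbit (codedShift p q c r ε)) (orbitCode ε)
        (orbitSpace p q c (juliaSet p q c)) := fun z hz => h.projectedOrbit_orbitCode hz
    exact hleft.injOn.bijOn_image.symm ⟨hleft.rightInvOn_image, hleft⟩

end IsCoding

theorem exists_eq_of_isImage_of_norm_sub_lt (hq : q ≠ 0) {a : ℝ} (ha : 0 < a) :
    ∃ r > (0 : ℝ), ∀ z : ℂ, a ≤ ‖z‖ → ∀ v v', IsImage p q c z v → IsImage p q c z v' →
      ‖v - v'‖ < 2 * r → v = v' := by
  obtain ⟨κ, hκ, hsep⟩ := exists_eq_of_pow_eq_of_norm_sub_lt (K := ℂ) hq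
  set b := min 1 (a ^ p)
  have hb0 : 0 < b := by positivity
  refine ⟨κ * b / 2, by positivity, fun z hz v v' hv hv' hlt => ?_⟩
  have hbv : b ≤ ‖v' - c‖ := by
    refine le_of_pow_le_pow_left₀ hq (norm_nonneg _) ?_
    calc b ^ q ≤ b := pow_le_of_le_one hb0.le (min_le_left _ _) hq
      _ ≤ a ^ p := min_le_right _ _
      _ ≤ ‖z‖ ^ p := by gcongr
      _ = ‖v' - c‖ ^ q := by rw [← norm_pow, ← norm_pow, hv']
  refine sub_left_injective (hsep (v - c) (v' - c) (hv.trans hv'.symm) ?_)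
  rw [sub_sub_sub_cancel_right]
  calc ‖v - v'‖ < κ * b := by linarith
    _ ≤ κ * ‖v' - c‖ := by gcongr

theorem IsHyperbolicRepeller.exists_isCoding (h : IsHyperbolicRepeller p q c Λ) (hq : q ≠ 0)
    (hpq : q ≤ p) : ∃ U r R ε, IsCoding p q c Λ U r R ε := by
  obtain ⟨a, ha, hlow⟩ := h.exists_le_norm (by omega) hq
  obtain ⟨r, hr, hsep⟩ :=
    exists_eq_of_isImage_of_norm_sub_lt (p := p) (c := c) hq (half_pos ha)
  obtain ⟨η, hη, hisolating⟩ := h.exists_isolating hq hpq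
  obtain ⟨R, hR, hΛR⟩ := h.isCompact.isBounded.exists_pos_norm_le
  set U := Metric.thickening (min (a / 2) η) Λ
  have hUη : U ⊆ Metric.thickening η Λ := Metric.thickening_mono (min_le_right _ _) Λ
  have hUlow : ∀ z ∈ U, a / 2 ≤ ‖z‖ := fun z hz => by
    obtain ⟨y, hy, hyz⟩ := Metric.mem_thickening_iff.1 hz
    rw [dist_comm, dist_eq_norm] at hyz
    linarith [norm_sub_norm_le y z, (hlow y hy).1, min_le_left (a / 2) η]
  set e := r / (2 * (R + r)) with he
  have he0 : 0 < e := by positivity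
  have he1 : e < 1 := by rw [he, div_lt_one (by positivity)]; linarith
  have her : e * (R + r) < r := by
    rw [show e * (R + r) = r / 2 by rw [he]; field_simp]
    exact half_lt_self hr
  have hnorm : ‖(e : ℂ)‖ = e := Complex.norm_of_nonneg he0.le
  exact ⟨U, r, R, e,
    { isOpen := Metric.isOpen_thickening
      zero_notMem := fun h0 => by linarith [hUlow 0 h0, norm_zero (E := ℂ)]
      subset := Metric.self_subset_thickening (lt_min (half_pos ha) hη) Λ
      mem_of_mem_orbitSpace := fun z hz => hisolating z fun i => ⟨hUη (hz i).1, (hz i).2⟩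
      eq_of_isImage := fun z hz => hsep z (hUlow z hz)
      norm_le := hΛR
      ε_ne_zero := Complex.ofReal_ne_zero.2 he0.ne'
      norm_ε_lt_one := hnorm.trans_lt he1
      norm_ε_mul_lt := by rwa [hnorm] }⟩

theorem exists_isC2Extension (h : IsHyperbolicRepeller p q c (juliaSet p q c))
    (hLEO : IsLEO p q c (juliaSet p q c)) (hq : q ≠ 0) (hpq : q ≤ p) :
    ∃ V f, IsC2Extension p q c V f := by
  obtain ⟨U, r, R, ε, hcoding⟩ := h.exists_isCoding hq hpq
  exact ⟨_, _, hcoding.isC2Extension h hLEO hq hpq⟩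

end CodedShift

end Corr

end

theorem mainTheorem1_general (p q : ℕ) (hq : q ≠ 0) (hpq : q < p) (c : ℂ)
    (hne : (Corr.juliaSet p q c).Nonempty)
    (hrep : Corr.IsHyperbolicRepeller p q c (Corr.juliaSet p q c))
    (hLEO : Corr.IsLEO p q c (Corr.juliaSet p q c)) :
    (∃ (V : Set (ℂ × ℂ)) (f : ℂ × ℂ → ℂ × ℂ), Corr.IsC2Extension p q c V f) ∧
    ∃ t : ℝ, 0 < t ∧
      (∀ (V : Set (ℂ × ℂ)) (f : ℂ × ℂ → ℂ × ℂ), Corr.IsC2Extension p q c V f → ∀ s : ℝ,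
          (Corr.pressure f (Corr.closurePeriodicPts V f)
            (fun x => s * Corr.geometricPotential p q c f x) = 0 ↔ s = t)) ∧
      MeasureTheory.Measure.hausdorffMeasure t (Corr.juliaSet p q c) < ⊤ ∧
      dimH (Corr.juliaSet p q c) ≤ ENNReal.ofReal t := by
  refine ⟨Corr.exists_isC2Extension hrep hLEO hq hpq.le, ?_⟩
  choose P hP using hrep.exists_isGrowthRate hLEO hne hq hpq.le
  obtain ⟨t, ht, hzero⟩ := hrep.exists_pos_forall_growthRate_eq_zero_iff hne hq hpq hP
  have hfinite : MeasureTheory.Measure.hausdorffMeasure t (Corr.juliaSet p q c) < ⊤ := by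
    obtain ⟨k, hk⟩ := hP t
    simp only [(hzero t).2 rfl, mul_zero, zero_add] at hk
    exact hrep.hausdorffMeasure_lt_top hq hpq.le ht.le fun n w hw => (hk n w hw).2
  refine ⟨t, ht, fun V f hf s => ?_, hfinite, ?_⟩
  · rw [hf.pressure_eq hrep hne hq hpq.le (hP s), EReal.coe_eq_zero]
    exact hzero s
  · refine dimH_le_of_hausdorffMeasure_ne_top (d := t.toNNReal) ?_
    rw [Real.coe_toNNReal _ ht.le]
    exact hfinite.ne

theorem mainTheorem1 (p q : ℕ) (hq : 2 ≤ q) (hpq : q < p) (c : ℂ)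
    (hne : (Corr.juliaSet p q c).Nonempty)
    (hrep : Corr.IsHyperbolicRepeller p q c (Corr.juliaSet p q c))
    (hLEO : Corr.IsLEO p q c (Corr.juliaSet p q c)) :
    (∃ (V : Set (ℂ × ℂ)) (f : ℂ × ℂ → ℂ × ℂ), Corr.IsC2Extension p q c V f) ∧
    ∃ t : ℝ, 0 < t ∧
      (∀ (V : Set (ℂ × ℂ)) (f : ℂ × ℂ → ℂ × ℂ), Corr.IsC2Extension p q c V f →
        ∀ s : ℝ, 0 ≤ s →
          (Corr.pressure f (Corr.closurePeriodicPts V f)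
            (fun x => s * Corr.geometricPotential p q c f x) = 0 ↔ s = t)) ∧
      MeasureTheory.Measure.hausdorffMeasure t (Corr.juliaSet p q c) < ⊤ ∧
      dimH (Corr.juliaSet p q c) ≤ ENNReal.ofReal t := by
  obtain ⟨hexists, t, ht, hzero, hfinite, hdim⟩ :=
    mainTheorem1_general p q (by omega) hpq c hne hrep hLEO
  exact ⟨hexists, t, ht, fun V f hf s _ => hzero V f hf s, hfinite, hdim⟩
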